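/- Let $N\ge 0$ be an integer, $Q\ge 1$ and $\delta\in(0,1)$. Definitions. A Jacobi difference expression $\tau$ with real coefficients $(a_n)_{n\in\mathbb Z}$, $a_n\neq 0$, and $(b_n)_{n\in\mathbb Z}$ acts by $(\tau f)(n)=a_{n-1}f(n-1)+a_nf(n+1)+b_nf(n)$. Suppose $a_n>0$ for all $n$, $\operatorname{supp}(b)\subset\{0,\dots,N\}$ and $\operatorname{supp}(a-1)\subset\{0,\dots,N-1\}$. For $z\in\mathbb C\setminus\{0\}$ let $f^\pm(\cdot,z)$ be the Jost solutions, i.e. the unique solutions of $\tau f=(z+z^{-1})f$ with $f^+(n,z)=z^n$ for $n\ge N$ and $f^-(n,z)=z^{-n}$ for $n\le 0$. Let $[f,g]=a_n\bigl(f(n)g(n+1)-f(n+1)g(n)\bigr)$, which does not depend on $n$ for two solutions with the same $z+z^{-1}$, and put $$\alpha(z)=\frac{z[f^+(z),f^-(z)]}{1-z^2},\quad \beta^-(z)=-\frac{z[f^+(z),f^-(z^{-1})]}{1-z^2},\quad s(z)=z[f^-(z^{-1}),f^+(z)]=(1-z^2)\beta^-(z).$$ The left reflection coefficient is the rational function $\mathcal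 R^-=\beta^- /\alpha$. Let $B_\delta(N,Q)$ be the set of all such $\tau$ with $\|a\|_\infty,\|1/a\|_\infty,\|b\|_\infty\le Q$, $|b_0|\ge\delta$ and $|s(1)|\ge\delta$. Theorem. There is a constant $C=C(N,Q,\delta)>0$ such that for all $R\ge 1$ and $\varepsilon>0$ the following holds. Let $\tau,\tilde\tau\in B_\delta(N,Q)$ have coefficients $a,b$ and $\tilde a,\tilde b$ and left reflection coefficients $\mathcal R^-$ and $\tilde{\mathcal R}^-$. Suppose that in the disk $|z|<R$ the functions $\mathcal R^-$ and $\tilde{\mathcal R}^-$ have the same number of zeros, counted with multiplicity, and that these can be listed as $\zeta_1,\dots,\zeta_m$ and $\tilde\zeta_1,\dots,\tilde\zeta_m$ with $|\zeta_j-\tilde\zeta_j|\le\varepsilon$ for all $j$; and suppose that the same holds for their poles in $|z|<R$. Then for every $n\in\mathbb Z$ $$|b_n-\tilde b_n|\le C\Bigl(\varepsilon+\frac1R\Bigr),\qquad |a_n^2-\tilde a_n^2|\le C\Bigl(\varepsilon+\frac1R\Bigr).$$ -/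

import Mathlib

/-- A Jacobi difference expression on `ℤ`: real sequences `a`, `b` with `a n ≠ 0` for all `n`. -/
structure JacobiDE where
  a : ℤ → ℝ
  b : ℤ → ℝ
  a_ne_zero : ∀ n, a n ≠ 0

namespace JacobiDE

/-- `(τ f)(n) = a_{n-1} f(n-1) + a_n f(n+1) + b_n f(n)`. -/
def apply (τ : JacobiDE) (f : ℤ → ℂ) (n : ℤ) : ℂ :=
  (τ.a (n - 1) : ℂ) * f (n - 1) + (τ.a n : ℂ) * f (n + 1) + (τ.b n : ℂ) * f n

/-- Finitely supported perturbation of the free expression: `a > 0`,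
`supp b ⊆ {Nm, …, Np}` and `supp (a - 1) ⊆ {Nm, …, Np - 1}`. -/
structure FinitelySupported (τ : JacobiDE) (Nm Np : ℤ) : Prop where
  le : Nm ≤ Np
  a_pos : ∀ n, 0 < τ.a n
  a_supp : ∀ n, τ.a n ≠ 1 → Nm ≤ n ∧ n ≤ Np - 1
  b_supp : ∀ n, τ.b n ≠ 0 → Nm ≤ n ∧ n ≤ Np

/-! Solutions of `τ f = lam f` with prescribed values at `n₀` and `n₀ + 1`. -/

/-- The pair `(f(n₀ + k), f(n₀ + k + 1))`, where `f(n₀) = u`, `f(n₀ + 1) = v`. -/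
noncomputable def solveFwd (τ : JacobiDE) (lam : ℂ) (n₀ : ℤ) (u v : ℂ) : ℕ → ℂ × ℂ
  | 0 => (u, v)
  | k + 1 =>
    ((solveFwd τ lam n₀ u v k).2,
      ((lam - (τ.b (n₀ + k + 1) : ℂ)) * (solveFwd τ lam n₀ u v k).2
        - (τ.a (n₀ + k) : ℂ) * (solveFwd τ lam n₀ u v k).1) / (τ.a (n₀ + k + 1) : ℂ))

/-- The pair `(f(n₀ - k), f(n₀ - k + 1))`, where `f(n₀) = u`, `f(n₀ + 1) = v`. -/
noncomputable def solveBwd (τ : JacobiDE) (lam : ℂ) (n₀ : ℤ) (u v : ℂ) : ℕ → ℂ × ℂ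
  | 0 => (u, v)
  | k + 1 =>
    (((lam - (τ.b (n₀ - k) : ℂ)) * (solveBwd τ lam n₀ u v k).1
        - (τ.a (n₀ - k) : ℂ) * (solveBwd τ lam n₀ u v k).2) / (τ.a (n₀ - k - 1) : ℂ),
      (solveBwd τ lam n₀ u v k).1)

/-- The solution `f` of `τ f = lam f` with `f(n₀) = u` and `f(n₀ + 1) = v`. -/
noncomputable def solution (τ : JacobiDE) (lam : ℂ) (n₀ : ℤ) (u v : ℂ) (n : ℤ) : ℂ :=
  if n₀ ≤ n then (solveFwd τ lam n₀ u v (n - n₀).toNat).1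
  else (solveBwd τ lam n₀ u v (n₀ - n).toNat).1

theorem solution_add (τ : JacobiDE) (lam : ℂ) (n₀ : ℤ) (u v : ℂ) (k : ℕ) :
    solution τ lam n₀ u v (n₀ + k) = (solveFwd τ lam n₀ u v k).1 := by
  simp [solution]

theorem solution_sub (τ : JacobiDE) (lam : ℂ) (n₀ : ℤ) (u v : ℂ) (k : ℕ) :
    solution τ lam n₀ u v (n₀ - k) = (solveBwd τ lam n₀ u v k).1 := by
  rcases k with _ | k
  · simp [solution, solveFwd, solveBwd]
  · have h : ¬ n₀ ≤ n₀ - ((k + 1 : ℕ) : ℤ) := by push_cast; omega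
    have h2 : (n₀ - (n₀ - ((k + 1 : ℕ) : ℤ))).toNat = k + 1 := by push_cast; omega
    rw [solution, if_neg h, h2]

theorem apply_solution (τ : JacobiDE) (lam : ℂ) (n₀ : ℤ) (u v : ℂ) (n : ℤ) :
    τ.apply (solution τ lam n₀ u v) n = lam * solution τ lam n₀ u v n := by
  rcases lt_or_ge n₀ n with h | h
  · obtain ⟨k, rfl⟩ : ∃ k : ℕ, n = n₀ + k + 1 := ⟨(n - n₀ - 1).toNat, by omega⟩
    have ha : (τ.a (n₀ + k + 1) : ℂ) ≠ 0 := by exact_mod_cast τ.a_ne_zero _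
    have e0 := solution_add τ lam n₀ u v k
    have e1 := solution_add τ lam n₀ u v (k + 1)
    have e2 := solution_add τ lam n₀ u v (k + 2)
    have i1 : n₀ + ((k + 1 : ℕ) : ℤ) = n₀ + k + 1 := by push_cast; ring
    have i2 : n₀ + ((k + 2 : ℕ) : ℤ) = n₀ + k + 1 + 1 := by push_cast; ring
    rw [i1] at e1
    rw [i2] at e2
    have i3 : n₀ + (k : ℤ) + 1 - 1 = n₀ + k := by ring
    rw [apply, i3, e0, e1, e2]
    simp only [solveFwd]
    field_simp
    ring
  · obtain ⟨k, rfl⟩ : ∃ k : ℕ, n = n₀ - k := ⟨(n₀ - n).toNat, by omega⟩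
    have ha : (τ.a (n₀ - k - 1) : ℂ) ≠ 0 := by exact_mod_cast τ.a_ne_zero _
    have e0 := solution_sub τ lam n₀ u v k
    have e1 := solution_sub τ lam n₀ u v (k + 1)
    have i1 : n₀ - ((k + 1 : ℕ) : ℤ) = n₀ - k - 1 := by push_cast; ring
    rw [i1] at e1
    have e2 : solution τ lam n₀ u v (n₀ - k + 1) = (solveBwd τ lam n₀ u v k).2 := by
      rcases k with _ | k
      · simpa [solveFwd, solveBwd] using solution_add τ lam n₀ u v 1
      · have i2 : n₀ - ((k + 1 : ℕ) : ℤ) + 1 = n₀ - k := by push_cast; ring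
        rw [i2, solution_sub]
        simp [solveBwd]
    rw [apply, e0, e1, e2]
    simp only [solveBwd]
    field_simp
    ring

/-- A solution of `τ f = lam f` is determined by two consecutive values. -/
theorem eq_solution (τ : JacobiDE) (lam : ℂ) (n₀ : ℤ) (f : ℤ → ℂ)
    (hf : ∀ n, τ.apply f n = lam * f n) :
    f = solution τ lam n₀ (f n₀) (f (n₀ + 1)) := by
  have hF : ∀ k : ℕ, solveFwd τ lam n₀ (f n₀) (f (n₀ + 1)) k = (f (n₀ + k), f (n₀ + k + 1)) := by
    intro k
    induction k with
    | zero => simp [solveFwd]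
    | succ k ih =>
      have ha : (τ.a (n₀ + k + 1) : ℂ) ≠ 0 := by exact_mod_cast τ.a_ne_zero _
      have h := hf (n₀ + k + 1)
      rw [apply, add_sub_cancel_right] at h
      have i1 : n₀ + ((k + 1 : ℕ) : ℤ) = n₀ + k + 1 := by push_cast; ring
      rw [solveFwd, ih, i1]
      refine Prod.ext rfl ?_
      simp only
      rw [div_eq_iff ha]
      linear_combination -h
  have hB : ∀ k : ℕ, solveBwd τ lam n₀ (f n₀) (f (n₀ + 1)) k = (f (n₀ - k), f (n₀ - k + 1)) := by
    intro k
    induction k with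
    | zero => simp [solveBwd]
    | succ k ih =>
      have ha : (τ.a (n₀ - k - 1) : ℂ) ≠ 0 := by exact_mod_cast τ.a_ne_zero _
      have h := hf (n₀ - k)
      rw [apply] at h
      have i1 : n₀ - ((k + 1 : ℕ) : ℤ) = n₀ - k - 1 := by push_cast; ring
      rw [solveBwd, ih, i1, sub_add_cancel]
      refine Prod.ext ?_ rfl
      simp only
      rw [div_eq_iff ha]
      linear_combination -h
  funext n
  rcases le_or_gt n₀ n with h | h
  · obtain ⟨k, rfl⟩ : ∃ k : ℕ, n = n₀ + k := ⟨(n - n₀).toNat, by omega⟩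
    rw [solution_add, hF]
  · obtain ⟨k, rfl⟩ : ∃ k : ℕ, n = n₀ - k := ⟨(n₀ - n).toNat, by omega⟩
    rw [solution_sub, hB]

/-- The Jost solution `f⁺(·, z)`: `τ f = (z + z⁻¹) f` and `f(n) = z ^ n` for `n ≥ Np`. -/
noncomputable def jostPlus (τ : JacobiDE) (Np : ℤ) (z : ℂ) : ℤ → ℂ :=
  solution τ (z + z⁻¹) Np (z ^ Np) (z ^ (Np + 1))

/-- The Jost solution `f⁻(·, z)`: `τ f = (z + z⁻¹) f` and `f(n) = z ^ (-n)` for `n ≤ Nm`. -/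
noncomputable def jostMinus (τ : JacobiDE) (Nm : ℤ) (z : ℂ) : ℤ → ℂ :=
  solution τ (z + z⁻¹) (Nm - 1) (z ^ (-(Nm - 1))) (z ^ (-Nm))

theorem jostPlus_unique {τ : JacobiDE} {Nm Np : ℤ} (h : τ.FinitelySupported Nm Np)
    {z : ℂ} (hz : z ≠ 0) (f : ℤ → ℂ) :
    ((∀ n, τ.apply f n = (z + z⁻¹) * f n) ∧ ∀ n, Np ≤ n → f n = z ^ n) ↔
      f = τ.jostPlus Np z := by
  constructor
  · rintro ⟨h1, h2⟩
    have := eq_solution τ (z + z⁻¹) Np f h1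
    rwa [h2 Np le_rfl, h2 (Np + 1) (by omega)] at this
  · rintro rfl
    refine ⟨fun n => apply_solution _ _ _ _ _ n, fun n hn => ?_⟩
    have ha : ∀ m, Np ≤ m → τ.a m = 1 := fun m hm => by
      by_contra hc
      have := h.a_supp m hc
      omega
    have hb : ∀ m, Np < m → τ.b m = 0 := fun m hm => by
      by_contra hc
      have := h.b_supp m hc
      omega
    have key : ∀ k : ℕ, solveFwd τ (z + z⁻¹) Np (z ^ Np) (z ^ (Np + 1)) k
        = (z ^ (Np + k), z ^ (Np + k + 1)) := by
      intro k
      induction k with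
      | zero => simp [solveFwd]
      | succ k ih =>
        have i1 : Np + ((k + 1 : ℕ) : ℤ) = Np + k + 1 := by push_cast; ring
        rw [solveFwd, ih, ha (Np + k) (by omega), ha (Np + k + 1) (by omega),
          hb (Np + k + 1) (by omega), i1]
        refine Prod.ext rfl ?_
        simp only [zpow_add₀ hz, zpow_one]
        push_cast
        field_simp
        ring
    obtain ⟨k, rfl⟩ : ∃ k : ℕ, n = Np + k := ⟨(n - Np).toNat, by omega⟩
    rw [jostPlus, solution_add, key]

theorem jostMinus_unique {τ : JacobiDE} {Nm Np : ℤ} (h : τ.FinitelySupported Nm Np)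
    {z : ℂ} (hz : z ≠ 0) (f : ℤ → ℂ) :
    ((∀ n, τ.apply f n = (z + z⁻¹) * f n) ∧ ∀ n, n ≤ Nm → f n = z ^ (-n)) ↔
      f = τ.jostMinus Nm z := by
  constructor
  · rintro ⟨h1, h2⟩
    have := eq_solution τ (z + z⁻¹) (Nm - 1) f h1
    rwa [sub_add_cancel, h2 Nm le_rfl, h2 (Nm - 1) (by omega)] at this
  · rintro rfl
    refine ⟨fun n => apply_solution _ _ _ _ _ n, fun n hn => ?_⟩
    have ha : ∀ m, m < Nm → τ.a m = 1 := fun m hm => by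
      by_contra hc
      have := h.a_supp m hc
      omega
    have hb : ∀ m, m < Nm → τ.b m = 0 := fun m hm => by
      by_contra hc
      have := h.b_supp m hc
      omega
    have key : ∀ k : ℕ, solveBwd τ (z + z⁻¹) (Nm - 1) (z ^ (-(Nm - 1))) (z ^ (-Nm)) k
        = (z ^ (-(Nm - 1 - k)), z ^ (-(Nm - k))) := by
      intro k
      induction k with
      | zero => simp [solveBwd]
      | succ k ih =>
        rw [solveBwd, ih, ha (Nm - 1 - k) (by omega), ha (Nm - 1 - k - 1) (by omega),
          hb (Nm - 1 - k) (by omega)]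
        have i1 : -(Nm - 1 - (k : ℤ)) = -(Nm - k) + 1 := by ring
        have i2 : -(Nm - 1 - ((k + 1 : ℕ) : ℤ)) = -(Nm - k) + 1 + 1 := by push_cast; ring
        have i3 : -(Nm - ((k + 1 : ℕ) : ℤ)) = -(Nm - k) + 1 := by push_cast; ring
        rw [i1, i2, i3]
        refine Prod.ext ?_ rfl
        simp only [zpow_add₀ hz, zpow_one]
        push_cast
        field_simp
        ring
    rcases eq_or_lt_of_le hn with rfl | hn
    · have := solution_add τ (z + z⁻¹) (n - 1) (z ^ (-(n - 1))) (z ^ (-n)) 1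
      simpa [jostMinus, solveFwd] using this
    · obtain ⟨k, rfl⟩ : ∃ k : ℕ, n = Nm - 1 - k := ⟨(Nm - 1 - n).toNat, by omega⟩
      rw [jostMinus, solution_sub, key]

/-- The modified Wronskian `[f, g]_n = a_n (f(n) g(n+1) - f(n+1) g(n))`. -/
def wronskian (τ : JacobiDE) (f g : ℤ → ℂ) (n : ℤ) : ℂ :=
  (τ.a n : ℂ) * (f n * g (n + 1) - f (n + 1) * g n)

/-- The Wronskian of two solutions for the same spectral parameter does not depend on `n`. -/
theorem wronskian_eq (τ : JacobiDE) {lam : ℂ} {f g : ℤ → ℂ}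
    (hf : ∀ n, τ.apply f n = lam * f n) (hg : ∀ n, τ.apply g n = lam * g n) (m n : ℤ) :
    τ.wronskian f g m = τ.wronskian f g n := by
  have step : ∀ k, τ.wronskian f g (k - 1) = τ.wronskian f g k := by
    intro k
    have h1 := hf k
    have h2 := hg k
    simp only [apply] at h1 h2
    simp only [wronskian, sub_add_cancel]
    linear_combination g k * h1 - f k * h2
  have all : ∀ k, τ.wronskian f g k = τ.wronskian f g 0 := by
    intro k
    induction k with
    | zero => rfl
    | succ i ih => rw [← ih, ← step (i + 1), add_sub_cancel_right]
    | pred i ih => rw [step, ih]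
  rw [all m, all n]

/-- `α(z) = z [f⁺(z), f⁻(z)] / (1 - z²)`; the Wronskian is evaluated at the index `0`. -/
noncomputable def alpha (τ : JacobiDE) (Nm Np : ℤ) (z : ℂ) : ℂ :=
  z * τ.wronskian (τ.jostPlus Np z) (τ.jostMinus Nm z) 0 / (1 - z ^ 2)

/-- `β⁻(z) = - z [f⁺(z), f⁻(z⁻¹)] / (1 - z²)`. -/
noncomputable def betaMinus (τ : JacobiDE) (Nm Np : ℤ) (z : ℂ) : ℂ :=
  -(z * τ.wronskian (τ.jostPlus Np z) (τ.jostMinus Nm z⁻¹) 0 / (1 - z ^ 2))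

/-- The left reflection coefficient `β⁻ / α`. It is a rational function; only its germs on
punctured neighbourhoods are used below, so its values at `0`, `±1` and its poles are irrelevant. -/
noncomputable def leftReflection (τ : JacobiDE) (Nm Np : ℤ) (z : ℂ) : ℂ :=
  τ.betaMinus Nm Np z / τ.alpha Nm Np z

/-- `s(z) = s⁻(z) = z [f⁻(z⁻¹), f⁺(z)]`. -/
noncomputable def sMinus (τ : JacobiDE) (Nm Np : ℤ) (z : ℂ) : ℂ :=
  z * τ.wronskian (τ.jostMinus Nm z⁻¹) (τ.jostPlus Np z) 0

/-- The class `B₀(N, Q)`. -/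
structure MemB0 (τ : JacobiDE) (N : ℕ) (Q : ℝ) : Prop where
  supp : τ.FinitelySupported 0 N
  a_le : ∀ n, |τ.a n| ≤ Q
  inv_a_le : ∀ n, |1 / τ.a n| ≤ Q
  b_le : ∀ n, |τ.b n| ≤ Q

/-- The class `B_δ(N, Q)`. -/
structure MemB (τ : JacobiDE) (δ : ℝ) (N : ℕ) (Q : ℝ) : Prop extends τ.MemB0 N Q where
  b_zero : δ ≤ |τ.b 0|
  s_one : δ ≤ ‖τ.sMinus 0 N 1‖

end JacobiDE

/-- `z` lists the zeros of the meromorphic function `f` in the disk `|ζ| < R`, each repeated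
according to its multiplicity. -/
def ListsZeros (f : ℂ → ℂ) (R : ℝ) {m : ℕ} (z : Fin m → ℂ) : Prop :=
  (∀ j, ‖z j‖ < R) ∧
    ∀ ζ : ℂ, ‖ζ‖ < R → Nat.card {j // z j = ζ} = (meromorphicOrderAt f ζ).untop₀.toNat

/-- `z` lists the poles of the meromorphic function `f` in the disk `|ζ| < R`, each repeated
according to its multiplicity. -/
def ListsPoles (f : ℂ → ℂ) (R : ℝ) {m : ℕ} (z : Fin m → ℂ) : Prop :=
  (∀ j, ‖z j‖ < R) ∧
    ∀ ζ : ℂ, ‖ζ‖ < R → Nat.card {j // z j = ζ} = (-(meromorphicOrderAt f ζ).untop₀).toNat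

/-- In the disk `|ζ| < R`, `f` and `g` have the same number of zeros, and these can be listed
so that corresponding zeros are at distance at most `ε`. -/
def ZerosClose (f g : ℂ → ℂ) (R ε : ℝ) : Prop :=
  ∃ (m : ℕ) (z w : Fin m → ℂ),
    ListsZeros f R z ∧ ListsZeros g R w ∧ ∀ j, ‖z j - w j‖ ≤ ε

/-- In the disk `|ζ| < R`, `f` and `g` have the same number of poles, and these can be listed
so that corresponding poles are at distance at most `ε`. -/
def PolesClose (f g : ℂ → ℂ) (R ε : ℝ) : Prop :=
  ∃ (m : ℕ) (z w : Fin m → ℂ),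
    ListsPoles f R z ∧ ListsPoles g R w ∧ ∀ j, ‖z j - w j‖ ≤ ε

/-!
The left reflection coefficient is handled as a quotient of two polynomials. Writing
`f⁺(n, z) = zⁿ Pₙ(z)`, the equation for `f⁺` becomes
`a_{n-1} P_{n-1} = (1 + z² - bₙ z) Pₙ - aₙ z² P_{n+1}` for all `n`, and `R⁻ = s / t` with
`s = P₀ - P₋₁` and `t = P₋₁ - z² P₀` (`leftReflection_eq`). Degrees and coefficients of `s` and `t`
are bounded uniformly over `B_δ(N, Q)`.

*From zeros and poles to Taylor coefficients.* Since `t(1) = -s(1)` with `|s(1)| ≥ δ`, one has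
`R⁻(1) = -1`, and the zeros of `s` and `t` keep a distance from `1`. So, after cancelling common
zeros, `R⁻ = -S / T`, where `S` and `T` are products of the factors `1 + (1 - z) / (ζ - 1)` over the
zeros and the poles `ζ` of `R⁻` (`numPoly_mul_normProd`). The parameter `1 / (ζ - 1)` is a bounded
Lipschitz function of `ζ`, and is `O(1/R)` when `|ζ| ≥ R`; a zero or pole outside the disk can
therefore be paired with the trivial factor at the cost `O(1/R)` (`exists_matched_factors`). As
`|T(0)|` is bounded below (`exists_uniform_bounds`), each Taylor coefficient of `R⁻` at `0` moves by
`O(ε + 1/R)` (`reflectionSeries_mem_lipSeries`).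

*From Taylor coefficients to `a` and `b`.* Put `mₙ = a_{n-1} Pₙ / P_{n-1}`. Then
`m₀ = (1 + R⁻) / (1 + z² R⁻)`, `mₙ(0) = a_{n-1}²` and
`a_{n-1}² / mₙ = 1 - bₙ z + z² (1 - m_{n+1})`, which yields all coefficients successively
(`weylSeries_mem_lipSeries`).

The estimates are organized algebraically: pairs of bounded functions of the data that differ by
`O(ε + 1/R)` form a ring (`lipRing`), in which elements bounded below are invertible, and power
series with coefficients in that ring (`lipSeries`) inherit both properties.
-/

open scoped Polynomial PowerSeries

/-! ### The Jost solution as a family of polynomials -/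

namespace JacobiDE

/-- The polynomial `jostPoly τ N (N + 1 - k)`, by recursion on `k`. -/
noncomputable def jostPolyAux (τ : JacobiDE) (N : ℕ) : ℕ → ℂ[X]
  | 0 => 1
  | 1 => 1
  | k + 2 => Polynomial.C ((τ.a (N - k - 1) : ℂ)⁻¹) *
      ((1 + Polynomial.X ^ 2 - Polynomial.C (τ.b (N - k) : ℂ) * Polynomial.X) * jostPolyAux τ N (k + 1)
        - Polynomial.C (τ.a (N - k) : ℂ) * Polynomial.X ^ 2 * jostPolyAux τ N k)

/-- The polynomial `P_n` with `f⁺(n, z) = z ^ n * P_n(z)`. It is `1` for `n ≥ N`. -/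
noncomputable def jostPoly (τ : JacobiDE) (N : ℕ) (n : ℤ) : ℂ[X] :=
  jostPolyAux τ N (N + 1 - n).toNat

theorem jostPoly_of_ge (τ : JacobiDE) {N : ℕ} {n : ℤ} (hn : N ≤ n) : τ.jostPoly N n = 1 := by
  have h : (N + 1 - n).toNat = 0 ∨ (N + 1 - n).toNat = 1 := by omega
  rcases h with h | h <;> simp [jostPoly, h, jostPolyAux]

/-- The equation `τ f⁺ = (z + z⁻¹) f⁺` in terms of the polynomials `P_n`. -/
theorem jostPoly_rec {τ : JacobiDE} {N : ℕ} (h : τ.FinitelySupported 0 N) (n : ℤ) :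
    Polynomial.C (τ.a (n - 1) : ℂ) * τ.jostPoly N (n - 1) =
      (1 + Polynomial.X ^ 2 - Polynomial.C (τ.b n : ℂ) * Polynomial.X) * τ.jostPoly N n
        - Polynomial.C (τ.a n : ℂ) * Polynomial.X ^ 2 * τ.jostPoly N (n + 1) := by
  rcases le_or_gt n N with hn | hn
  · obtain ⟨k, rfl⟩ : ∃ k : ℕ, n = N - k := ⟨(N - n).toNat, by omega⟩
    have e1 : ((N : ℤ) + 1 - (N - k - 1)).toNat = k + 2 := by omega
    have e2 : ((N : ℤ) + 1 - (N - k)).toNat = k + 1 := by omega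
    have e3 : ((N : ℤ) + 1 - (N - k + 1)).toNat = k := by omega
    have ha : (τ.a (N - k - 1) : ℂ) ≠ 0 := by exact_mod_cast τ.a_ne_zero _
    rw [jostPoly, jostPoly, jostPoly, e1, e2, e3, jostPolyAux, ← mul_assoc, ← map_mul,
      mul_inv_cancel₀ ha, map_one, one_mul]
  · have ha : ∀ m : ℤ, N ≤ m → τ.a m = 1 := fun m hm => by
      by_contra hc
      have := h.a_supp m hc
      omega
    have hb : τ.b n = 0 := by
      by_contra hc
      have := h.b_supp n hc
      omega
    rw [jostPoly_of_ge τ (by omega), jostPoly_of_ge τ hn.le, jostPoly_of_ge τ (by omega),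
      ha n hn.le, ha (n - 1) (by omega), hb]
    simp

theorem jostPlus_eq {τ : JacobiDE} {N : ℕ} (h : τ.FinitelySupported 0 N) {z : ℂ} (hz : z ≠ 0)
    (n : ℤ) : τ.jostPlus N z n = z ^ n * (τ.jostPoly N n).eval z := by
  have key := (jostPlus_unique h hz (fun n : ℤ => z ^ n * (τ.jostPoly N n).eval z)).1
    ⟨fun n => ?_, fun n hn => by simp [jostPoly_of_ge τ hn]⟩
  · exact (congrFun key n).symm
  · have := congrArg (Polynomial.eval z) (jostPoly_rec h n)
    simp only [Polynomial.eval_mul, Polynomial.eval_C, Polynomial.eval_sub, Polynomial.eval_add,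
      Polynomial.eval_one, Polynomial.eval_pow, Polynomial.eval_X] at this
    simp only [apply, zpow_add₀ hz, zpow_sub₀ hz, zpow_one]
    field_simp
    linear_combination this

theorem natDegree_jostPolyAux (τ : JacobiDE) (N : ℕ) :
    ∀ k, (τ.jostPolyAux N k).natDegree ≤ 2 * k
  | 0 => by simp [jostPolyAux]
  | 1 => by simp [jostPolyAux]
  | k + 2 => by
    have h1 := natDegree_jostPolyAux τ N (k + 1)
    have h2 := natDegree_jostPolyAux τ N k
    rw [jostPolyAux]
    refine (Polynomial.natDegree_C_mul_le _ _).trans ?_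
    refine (Polynomial.natDegree_sub_le _ _).trans (max_le ?_ ?_)
    · refine Polynomial.natDegree_mul_le.trans ?_
      have : (1 + Polynomial.X ^ 2
          - Polynomial.C (τ.b (N - k) : ℂ) * Polynomial.X).natDegree ≤ 2 := by
        compute_degree
      omega
    · refine Polynomial.natDegree_mul_le.trans ?_
      have : (Polynomial.C (τ.a (N - k) : ℂ) * Polynomial.X ^ 2).natDegree ≤ 2 := by
        compute_degree
      omega

theorem norm_coeff_jostPolyAux_le {τ : JacobiDE} {N : ℕ} {Q : ℝ} (hQ : 1 ≤ Q)
    (h : τ.MemB0 N Q) : ∀ k j, ‖(τ.jostPolyAux N k).coeff j‖ ≤ (4 * Q ^ 2) ^ k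
  | 0, j => by
    rw [jostPolyAux, Polynomial.coeff_one]
    split_ifs <;> simp
  | 1, j => by
    rw [jostPolyAux, Polynomial.coeff_one]
    split_ifs
    · simp; nlinarith
    · simp; positivity
  | k + 2, j => by
    have h1 := norm_coeff_jostPolyAux_le hQ h (k + 1)
    have h2 := norm_coeff_jostPolyAux_le hQ h k
    set K := (4 * Q ^ 2) ^ k with hK
    have hK0 : 0 ≤ K := by positivity
    have hKs : (4 * Q ^ 2) ^ (k + 1) = 4 * Q ^ 2 * K := by rw [pow_succ, hK]; ring
    have hKK : K ≤ 4 * Q ^ 2 * K := le_mul_of_one_le_left hK0 (by nlinarith)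
    rw [hKs] at h1
    have sh : ∀ (p : ℂ[X]) (B : ℝ), 0 ≤ B → (∀ j, ‖p.coeff j‖ ≤ B) →
        ∀ i j, ‖(Polynomial.X ^ i * p).coeff j‖ ≤ B := by
      intro p B hB hp i j
      rw [Polynomial.coeff_X_pow_mul']
      split_ifs
      · exact hp _
      · simpa using hB
    have ha := h.a_le (N - k)
    have hb := h.b_le (N - k)
    have hi := h.inv_a_le (N - k - 1)
    set p := τ.jostPolyAux N (k + 1)
    set q := τ.jostPolyAux N k
    have e : τ.jostPolyAux N (k + 2) = Polynomial.C ((τ.a (N - k - 1) : ℂ)⁻¹) *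
        (p + Polynomial.X ^ 2 * p - Polynomial.C (τ.b (N - k) : ℂ) * (Polynomial.X ^ 1 * p)
          - Polynomial.C (τ.a (N - k) : ℂ) * (Polynomial.X ^ 2 * q)) := by
      rw [jostPolyAux]; ring
    rw [e, Polynomial.coeff_C_mul, Polynomial.coeff_sub, Polynomial.coeff_sub, Polynomial.coeff_add,
      Polynomial.coeff_C_mul, Polynomial.coeff_C_mul, norm_mul]
    have n1 : ‖((τ.a (N - k - 1) : ℂ))⁻¹‖ ≤ Q := by
      rw [← Complex.ofReal_inv, Complex.norm_real]; simpa using hi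
    have hB : 0 ≤ 4 * Q ^ 2 * K := by positivity
    have n2 := h1 j
    have n3 := sh p _ hB h1 2 j
    have n4 : ‖(τ.b (N - k) : ℂ) * (Polynomial.X ^ 1 * p).coeff j‖ ≤ Q * (4 * Q ^ 2 * K) := by
      rw [norm_mul, Complex.norm_real]
      exact mul_le_mul hb (sh p _ hB h1 1 j) (norm_nonneg _) (by linarith)
    have n5 : ‖(τ.a (N - k) : ℂ) * (Polynomial.X ^ 2 * q).coeff j‖ ≤ Q * K := by
      rw [norm_mul, Complex.norm_real]
      exact mul_le_mul ha (sh q _ hK0 h2 2 j) (norm_nonneg _) (by linarith)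
    have n6 := norm_sub_le (p.coeff j + (Polynomial.X ^ 2 * p).coeff j
      - (τ.b (N - k) : ℂ) * (Polynomial.X ^ 1 * p).coeff j)
      ((τ.a (N - k) : ℂ) * (Polynomial.X ^ 2 * q).coeff j)
    have n7 := norm_sub_le (p.coeff j + (Polynomial.X ^ 2 * p).coeff j)
      ((τ.b (N - k) : ℂ) * (Polynomial.X ^ 1 * p).coeff j)
    have n8 := norm_add_le (p.coeff j) ((Polynomial.X ^ 2 * p).coeff j)
    have n9 := mul_le_mul_of_nonneg_left hKK (by linarith : 0 ≤ Q)
    calc _ ≤ Q * (4 * Q * (4 * Q ^ 2 * K)) := by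
          refine mul_le_mul n1 ?_ (norm_nonneg _) (by linarith)
          have := mul_le_mul_of_nonneg_right hQ hB
          linarith
      _ = (4 * Q ^ 2) ^ (k + 2) := by rw [hK]; ring

theorem le_norm_coeff_zero_jostPolyAux {τ : JacobiDE} {N : ℕ} {Q : ℝ} (hQ : 1 ≤ Q)
    (h : τ.MemB0 N Q) : ∀ k, (Q⁻¹) ^ k ≤ ‖(τ.jostPolyAux N k).coeff 0‖
  | 0 => by simp [jostPolyAux]
  | 1 => by simpa [jostPolyAux] using inv_le_one_of_one_le₀ hQ
  | k + 2 => by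
    have h1 := le_norm_coeff_zero_jostPolyAux hQ h (k + 1)
    have ha := h.a_le (N - k - 1)
    have ha0 : 0 < |τ.a (N - k - 1)| := abs_pos.2 (τ.a_ne_zero _)
    have e : (τ.jostPolyAux N (k + 2)).coeff 0
        = (τ.a (N - k - 1) : ℂ)⁻¹ * (τ.jostPolyAux N (k + 1)).coeff 0 := by
      simp [jostPolyAux, Polynomial.mul_coeff_zero]
    rw [e, norm_mul, norm_inv, Complex.norm_real, pow_succ' _ (k + 1)]
    exact mul_le_mul (inv_anti₀ ha0 ha) h1 (by positivity) (by positivity)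

/-- The polynomial `s(z) = z [f⁻(z⁻¹), f⁺(z)]`, the numerator of the left reflection coefficient. -/
noncomputable def numPoly (τ : JacobiDE) (N : ℕ) : ℂ[X] := τ.jostPoly N 0 - τ.jostPoly N (-1)

/-- The polynomial `z [f⁺(z), f⁻(z)]`, the denominator of the left reflection coefficient. -/
noncomputable def denPoly (τ : JacobiDE) (N : ℕ) : ℂ[X] :=
  τ.jostPoly N (-1) - Polynomial.X ^ 2 * τ.jostPoly N 0

theorem eval_one_denPoly (τ : JacobiDE) (N : ℕ) :
    (τ.denPoly N).eval 1 = -(τ.numPoly N).eval 1 := by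
  simp [denPoly, numPoly]

section Wronskian

variable {τ : JacobiDE} {N : ℕ} (h : τ.FinitelySupported 0 N) {z : ℂ} (hz : z ≠ 0)
include h hz

theorem wronskian_jost_eq {w : ℂ} (hw : w = z ∨ w = z⁻¹) :
    z * τ.wronskian (τ.jostPlus N z) (τ.jostMinus 0 w) 0
      = (τ.jostPoly N (-1)).eval z - z * w * (τ.jostPoly N 0).eval z := by
  have hw0 : w ≠ 0 := by rcases hw with rfl | rfl <;> simp [hz]
  have hl : w + w⁻¹ = z + z⁻¹ := by
    rcases hw with rfl | rfl
    · rfl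
    · rw [inv_inv, add_comm]
  have h1 := ((jostPlus_unique h hz _).2 rfl).1
  obtain ⟨h2, h3⟩ := (jostMinus_unique h hw0 _).2 rfl
  rw [hl] at h2
  have ha : τ.a (-1) = 1 := by
    by_contra hc
    have := h.a_supp _ hc
    omega
  rw [τ.wronskian_eq h1 h2 0 (-1), wronskian, jostPlus_eq h hz, jostPlus_eq h hz,
    h3 _ (by norm_num), h3 _ (by norm_num), ha]
  norm_num
  field_simp

theorem sMinus_eq : τ.sMinus 0 N z = (τ.numPoly N).eval z := by
  have h1 := wronskian_jost_eq h hz (Or.inr rfl)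
  rw [mul_inv_cancel₀ hz] at h1
  simp only [sMinus, numPoly, Polynomial.eval_sub]
  rw [wronskian] at h1 ⊢
  linear_combination -h1

theorem leftReflection_eq (hz1 : z ^ 2 ≠ 1) :
    τ.leftReflection 0 N z = (τ.numPoly N).eval z / (τ.denPoly N).eval z := by
  have h1 := wronskian_jost_eq h hz (Or.inr rfl)
  rw [mul_inv_cancel₀ hz] at h1
  have h2 := wronskian_jost_eq h hz (Or.inl rfl)
  have h3 : 1 - z ^ 2 ≠ 0 := sub_ne_zero.2 hz1.symm
  rw [leftReflection, betaMinus, alpha, h1, h2, ← neg_div, div_div_div_cancel_right₀ h3]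
  congr 1
  · simp [numPoly]
  · simp [denPoly, sq]

end Wronskian

end JacobiDE

/-! ### Pairs of functions that are close -/

/-- The ring of functions `u` on `ι × Bool`, regarded as pairs of functions on `ι`, which are
bounded and whose two components differ by `O(η)`. -/
def lipRing {ι : Type*} (η : ι → NNReal) : Subring (ι × Bool → ℂ) where
  carrier := {u | ∃ K : ℝ, (∀ y, ‖u y‖ ≤ K) ∧ ∀ x, ‖u (x, true) - u (x, false)‖ ≤ K * η x}
  zero_mem' := ⟨0, by simp, by simp⟩
  one_mem' := ⟨1, by simp, by simp⟩
  neg_mem' := by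
    rintro u ⟨K, h1, h2⟩
    refine ⟨K, by simpa using h1, fun x => ?_⟩
    rw [Pi.neg_apply, Pi.neg_apply, ← neg_sub', norm_neg]
    exact h2 x
  add_mem' := by
    rintro u v ⟨K, h1, h2⟩ ⟨L, h3, h4⟩
    refine ⟨K + L, fun y => (norm_add_le _ _).trans (add_le_add (h1 y) (h3 y)), fun x => ?_⟩
    rw [Pi.add_apply, Pi.add_apply, add_sub_add_comm, add_mul]
    exact (norm_add_le _ _).trans (add_le_add (h2 x) (h4 x))
  mul_mem' := by
    rintro u v ⟨K, h1, h2⟩ ⟨L, h3, h4⟩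
    refine ⟨K * L + K * L, fun y => ?_, fun x => ?_⟩
    · have hK := (norm_nonneg _).trans (h1 y)
      have hL := (norm_nonneg _).trans (h3 y)
      rw [Pi.mul_apply, norm_mul]
      have := mul_le_mul (h1 y) (h3 y) (norm_nonneg _) hK
      have := mul_nonneg hK hL
      linarith
    · have hK := (norm_nonneg _).trans (h1 (x, true))
      have e : (u * v) (x, true) - (u * v) (x, false)
          = u (x, true) * (v (x, true) - v (x, false))
            + v (x, false) * (u (x, true) - u (x, false)) := by
        simp only [Pi.mul_apply]; ring
      rw [e]
      refine (norm_add_le _ _).trans ?_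
      rw [norm_mul, norm_mul, add_mul]
      refine add_le_add ?_ ?_
      · rw [mul_assoc]
        exact mul_le_mul (h1 _) (h4 x) (norm_nonneg _) hK
      · rw [mul_comm K L, mul_assoc]
        exact mul_le_mul (h3 _) (h2 x) (norm_nonneg _) ((norm_nonneg _).trans (h3 (x, false)))

theorem inv_mem_lipRing {ι : Type*} {η : ι → NNReal} {u : ι × Bool → ℂ} (hu : u ∈ lipRing η)
    {c : ℝ} (hc : 0 < c) (h : ∀ y, c ≤ ‖u y‖) : (fun y => (u y)⁻¹) ∈ lipRing η := by
  obtain ⟨K, h1, h2⟩ := hu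
  refine ⟨c⁻¹ + c⁻¹ * c⁻¹ * K, fun y => ?_, fun x => ?_⟩
  · have hK := (norm_nonneg _).trans (h1 y)
    rw [norm_inv]
    have := inv_anti₀ hc (h y)
    have : 0 ≤ c⁻¹ * c⁻¹ * K := by positivity
    linarith
  · have h3 : u (x, true) ≠ 0 := norm_pos_iff.1 (hc.trans_le (h _))
    have h4 : u (x, false) ≠ 0 := norm_pos_iff.1 (hc.trans_le (h _))
    have e : (u (x, true))⁻¹ - (u (x, false))⁻¹
        = -((u (x, true))⁻¹ * (u (x, false))⁻¹ * (u (x, true) - u (x, false))) := by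
      field_simp; ring
    dsimp only
    rw [e, norm_neg, norm_mul, norm_mul, norm_inv, norm_inv]
    have : ‖u (x, true)‖⁻¹ * ‖u (x, false)‖⁻¹ * ‖u (x, true) - u (x, false)‖
        ≤ c⁻¹ * c⁻¹ * (K * η x) := by
      have a1 := inv_anti₀ hc (h (x, true))
      have a2 := inv_anti₀ hc (h (x, false))
      have a3 := h2 x
      gcongr
    have : 0 ≤ c⁻¹ * (η x : ℝ) := by positivity
    linarith

/-- Families of power series over `ι × Bool` all of whose coefficients lie in `lipRing η`. -/
def lipSeries {ι : Type*} (η : ι → NNReal) : Subring (ι × Bool → ℂ⟦X⟧) where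
  carrier := {F | ∀ k, (fun y => PowerSeries.coeff k (F y)) ∈ lipRing η}
  zero_mem' := fun k => by
    simp only [Pi.zero_apply, map_zero]
    exact (lipRing η).zero_mem
  one_mem' := fun k => by
    simp only [Pi.one_apply, PowerSeries.coeff_one]
    split_ifs
    exacts [(lipRing η).one_mem, (lipRing η).zero_mem]
  neg_mem' := fun {F} hF k => by
    simp only [Pi.neg_apply, map_neg]
    exact (lipRing η).neg_mem (hF k)
  add_mem' := fun {F G} hF hG k => by
    simp only [Pi.add_apply, map_add]
    exact (lipRing η).add_mem (hF k) (hG k)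
  mul_mem' := fun {F G} hF hG k => by
    have : (fun y => PowerSeries.coeff k ((F * G) y)) = ∑ p ∈ Finset.HasAntidiagonal.antidiagonal k,
        (fun y => PowerSeries.coeff p.1 (F y)) * fun y => PowerSeries.coeff p.2 (G y) := by
      funext y
      simp [PowerSeries.coeff_mul]
    rw [this]
    exact sum_mem fun p _ => mul_mem (hF p.1) (hG p.2)

theorem C_mem_lipSeries {ι : Type*} {η : ι → NNReal} {u : ι × Bool → ℂ} (hu : u ∈ lipRing η) :
    (fun y => PowerSeries.C (u y)) ∈ lipSeries η := fun k => by
  simp only [PowerSeries.coeff_C]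
  split_ifs
  exacts [hu, (lipRing η).zero_mem]

theorem X_mem_lipSeries {ι : Type*} {η : ι → NNReal} :
    (fun _ => PowerSeries.X) ∈ lipSeries η := fun k => by
  simp only [PowerSeries.coeff_X]
  split_ifs
  exacts [(lipRing η).one_mem, (lipRing η).zero_mem]

theorem inv_mem_lipSeries {ι : Type*} {η : ι → NNReal} {F : ι × Bool → ℂ⟦X⟧}
    (hF : F ∈ lipSeries η) {c : ℝ} (hc : 0 < c)
    (h : ∀ y, c ≤ ‖PowerSeries.constantCoeff (F y)‖) : (fun y => (F y)⁻¹) ∈ lipSeries η := by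
  have h0 : (fun y => (PowerSeries.constantCoeff (F y))⁻¹) ∈ lipRing η :=
    inv_mem_lipRing (by simpa using hF 0) hc h
  intro k
  induction k using Nat.strong_induction_on with
  | _ k ih =>
    by_cases hk : k = 0
    · subst hk; simpa using h0
    · have e : (fun y => PowerSeries.coeff k ((F y)⁻¹)) =
          -(fun y => (PowerSeries.constantCoeff (F y))⁻¹) * ∑ p ∈ Finset.HasAntidiagonal.antidiagonal k,
            if p.2 < k then (fun y => PowerSeries.coeff p.1 (F y)) *
              (fun y => PowerSeries.coeff p.2 ((F y)⁻¹)) else 0 := by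
        funext y
        rw [PowerSeries.coeff_inv, if_neg hk]
        simp only [Pi.mul_apply, Pi.neg_apply, Finset.sum_apply]
        congr 1
        refine Finset.sum_congr rfl fun p _ => ?_
        split_ifs <;> simp
      rw [e]
      refine mul_mem (neg_mem h0) (sum_mem fun p _ => ?_)
      split_ifs with hp
      · exact mul_mem (hF _) (ih _ hp)
      · exact zero_mem _

/-! ### Polynomials normalized at `1` and matching of zeros -/

/-- The polynomial `1 + (1 - z) w`, normalized to be `1` at `z = 1`. For `w = (ζ - 1)⁻¹` its only
zero is `ζ`; the parameter `w = 0` plays the role of `ζ = ∞`. -/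
noncomputable def linFactor (w : ℂ) : ℂ[X] := 1 + (1 - Polynomial.X) * Polynomial.C w

/-- The polynomial with the multiset `A` of zeros and the value `1` at `1` (if `1 ∉ A`). -/
noncomputable def normProd (A : Multiset ℂ) : ℂ[X] := (A.map fun ζ => linFactor (ζ - 1)⁻¹).prod

theorem normProd_add (A B : Multiset ℂ) : normProd (A + B) = normProd A * normProd B := by
  simp [normProd]

theorem eval_one_normProd (A : Multiset ℂ) : (normProd A).eval 1 = 1 := by
  induction A using Multiset.induction_on with
  | empty => simp [normProd]
  | cons a A ih =>
    rw [← Multiset.singleton_add, normProd_add, Polynomial.eval_mul, ih]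
    simp [normProd, linFactor]

theorem eq_C_mul_normProd_roots {f : ℂ[X]} (hf : f.eval 1 ≠ 0) :
    f = Polynomial.C (f.eval 1) * normProd f.roots := by
  have hr : ∀ ζ ∈ f.roots, ζ - 1 ≠ 0 := by
    intro ζ hζ h
    rw [sub_eq_zero.1 h] at hζ
    exact hf (Polynomial.isRoot_of_mem_roots hζ)
  have h1 : f = Polynomial.C (f.leadingCoeff * (f.roots.map fun ζ => 1 - ζ).prod) *
      normProd f.roots := by
    conv_lhs => rw [(IsAlgClosed.splits f).eq_prod_roots]
    rw [map_mul, mul_assoc, map_multiset_prod, normProd, Multiset.map_map, ← Multiset.prod_map_mul]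
    congr 2
    refine Multiset.map_congr rfl fun ζ hζ => ?_
    have e : (1 - ζ) * (ζ - 1)⁻¹ = -1 := by
      have := hr ζ hζ
      field_simp; ring
    have e2 := congrArg Polynomial.C e
    simp only [map_mul, map_neg, map_one, Polynomial.C_sub] at e2
    simp only [Function.comp, linFactor, Polynomial.C_sub, map_one]
    linear_combination -(1 - Polynomial.X) * e2
  have h2 := congrArg (Polynomial.eval 1) h1
  rw [Polynomial.eval_mul, Polynomial.eval_C, eval_one_normProd, mul_one] at h2
  rw [h2]
  exact h1

theorem norm_eval_zero_normProd_le {c : ℝ} (hc : 0 < c) (A : Multiset ℂ)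
    (hA : ∀ ζ ∈ A, c ≤ ‖ζ - 1‖) : ‖(normProd A).eval 0‖ ≤ (1 + c⁻¹) ^ A.card := by
  induction A using Multiset.induction_on with
  | empty => simp [normProd]
  | cons a A ih =>
    have ih := ih fun ζ hζ => hA ζ (Multiset.mem_cons_of_mem hζ)
    have ha := hA a (Multiset.mem_cons_self a A)
    rw [← Multiset.singleton_add, normProd_add, Polynomial.eval_mul, norm_mul,
      Multiset.card_add, Multiset.card_singleton, pow_add, pow_one]
    refine mul_le_mul ?_ ih (norm_nonneg _) (by positivity)
    have : (normProd {a}).eval 0 = 1 + (a - 1)⁻¹ := by simp [normProd, linFactor]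
    rw [this]
    refine (norm_add_le _ _).trans ?_
    rw [norm_one, norm_inv]
    have := inv_anti₀ hc ha
    linarith

/-- The zeros of a polynomial with bounded coefficients whose value at `1` is bounded away from `0`
keep a distance from `1`. -/
theorem exists_le_norm_root_sub_one (d : ℕ) {K δ : ℝ} (hK : 0 < K) (hδ : 0 < δ) :
    ∃ c : ℝ, 0 < c ∧ c ≤ 1 ∧ ∀ f : ℂ[X], f.natDegree ≤ d → (∀ j, ‖f.coeff j‖ ≤ K) →
      δ ≤ ‖f.eval 1‖ → ∀ ζ ∈ f.roots, c ≤ ‖ζ - 1‖ := by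
  obtain ⟨L, hL⟩ : ∃ L : ℝ,
      L = ∑ j ∈ Finset.range (d + 1), K * ∑ i ∈ Finset.range j, (2 : ℝ) ^ i + 1 := ⟨_, rfl⟩
  have hL0 : 0 < L := by
    rw [hL]
    exact add_pos_of_nonneg_of_pos (Finset.sum_nonneg fun j _ => mul_nonneg hK.le
      (Finset.sum_nonneg fun i _ => by positivity)) one_pos
  refine ⟨min 1 (δ / L), by positivity, min_le_left _ _, fun f hd hc h1 ζ hζ => ?_⟩
  by_contra! hlt
  have hz1 : ‖ζ - 1‖ < 1 := hlt.trans_le (min_le_left _ _)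
  have hz2 : ‖ζ‖ ≤ 2 := by
    have := norm_add_le (ζ - 1) 1
    rw [sub_add_cancel, norm_one] at this
    linarith
  have h0 : f.eval ζ = 0 := Polynomial.isRoot_of_mem_roots hζ
  have e : f.eval 1 = -(∑ j ∈ Finset.range (d + 1),
      f.coeff j * ((∑ i ∈ Finset.range j, ζ ^ i) * (ζ - 1))) := by
    rw [← sub_zero (f.eval 1), ← h0, Polynomial.eval_eq_sum_range' (Nat.lt_succ_of_le hd),
      Polynomial.eval_eq_sum_range' (Nat.lt_succ_of_le hd), ← Finset.sum_sub_distrib,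
      ← Finset.sum_neg_distrib]
    refine Finset.sum_congr rfl fun j _ => ?_
    rw [geom_sum_mul]
    simp; ring
  have h2 : ‖f.eval 1‖ ≤ L * ‖ζ - 1‖ := by
    rw [e, norm_neg, hL, add_mul, Finset.sum_mul]
    refine (norm_sum_le _ _).trans ((Finset.sum_le_sum fun j _ => ?_).trans
      (le_add_of_nonneg_right (by simp)))
    rw [norm_mul, norm_mul, ← mul_assoc]
    refine mul_le_mul_of_nonneg_right (mul_le_mul (hc j) ((norm_sum_le _ _).trans
      (Finset.sum_le_sum fun i _ => ?_)) (norm_nonneg _) hK.le) (norm_nonneg _)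
    rw [norm_pow]
    exact pow_le_pow_left₀ (norm_nonneg _) hz2 i
  have h3 : ‖ζ - 1‖ < δ / L := hlt.trans_le (min_le_right _ _)
  rw [lt_div_iff₀ hL0] at h3
  linarith

/-- A multiset of size at most `n` can be enumerated by `Fin n`, after padding with `a`. -/
theorem exists_fin_enum {α : Type*} (M : Multiset α) {n : ℕ} (h : M.card ≤ n) (a : α) :
    ∃ v : Fin n → α, Finset.univ.val.map v = M + Multiset.replicate (n - M.card) a := by
  have key : ∀ (k : ℕ) (W : Multiset α), W.card = k →
      ∃ v : Fin k → α, Finset.univ.val.map v = W := by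
    rintro _ W rfl
    induction W using Quotient.inductionOn with
    | _ l => exact ⟨l.get, (Fin.univ_val_map l.get).trans (by simp)⟩
  exact key n _ (by rw [Multiset.card_add, Multiset.card_replicate]; omega)

/-- If the parts of `A` and `B` inside the disk of radius `R` are matched up to `ε`, then
`normProd A` and `normProd B` are products of equally many factors `linFactor w` whose parameters
are matched up to `O(ε + 1/R)`: a zero outside the disk is paired with `∞`. -/
theorem exists_matched_factors {c : ℝ} (hc : 0 < c) (hc1 : c ≤ 1) {d : ℕ} {R ε : ℝ} (hR : 1 ≤ R)
    (hε : 0 < ε) {A B : Multiset ℂ} (hA : A.card ≤ d) (hB : B.card ≤ d)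
    (hAc : ∀ ζ ∈ A, c ≤ ‖ζ - 1‖) (hBc : ∀ ζ ∈ B, c ≤ ‖ζ - 1‖) {m : ℕ} {z w : Fin m → ℂ}
    (hz : Finset.univ.val.map z = A.filter fun ζ => ‖ζ‖ < R)
    (hw : Finset.univ.val.map w = B.filter fun ζ => ‖ζ‖ < R) (hzw : ∀ j, ‖z j - w j‖ ≤ ε) :
    ∃ v : Fin (2 * d) → ℂ × ℂ,
      normProd A = ∏ i, linFactor (v i).1 ∧ normProd B = ∏ i, linFactor (v i).2 ∧
      ∀ i, ‖(v i).1‖ ≤ 2 / c ^ 2 ∧ ‖(v i).2‖ ≤ 2 / c ^ 2 ∧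
        ‖(v i).1 - (v i).2‖ ≤ 2 / c ^ 2 * (ε + 1 / R) := by
  classical
  set g : ℂ → ℂ := fun ζ => (ζ - 1)⁻¹ with hg
  set A' := A.filter fun ζ => ¬ ‖ζ‖ < R
  set B' := B.filter fun ζ => ¬ ‖ζ‖ < R
  have hAA : Finset.univ.val.map z + A' = A := by rw [hz]; exact Multiset.filter_add_not _ _
  have hBB : Finset.univ.val.map w + B' = B := by rw [hw]; exact Multiset.filter_add_not _ _
  set M : Multiset (ℂ × ℂ) := Finset.univ.val.map (fun j => (g (z j), g (w j)))
    + A'.map (fun ζ => (g ζ, 0)) + B'.map (fun ζ => (0, g ζ)) with hM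
  have hcard : M.card ≤ 2 * d := by
    have h1 := congrArg Multiset.card hAA
    have h2 := congrArg Multiset.card hBB
    simp only [Multiset.card_add, Multiset.card_map, Finset.card_val, Finset.card_univ,
      Fintype.card_fin] at h1 h2
    simp only [hM, Multiset.card_add, Multiset.card_map, Finset.card_val, Finset.card_univ,
      Fintype.card_fin]
    omega
  have lin0 : linFactor 0 = 1 := by simp [linFactor]
  obtain ⟨v, hv⟩ := exists_fin_enum M hcard (0, 0)
  have c2 : 1 / c ≤ 1 / c ^ 2 := by
    apply one_div_le_one_div_of_le (by positivity)
    nlinarith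
  have c1 : 1 ≤ 1 / c ^ 2 := by
    rw [le_div_iff₀ (by positivity)]; nlinarith
  have e2 : 2 / c ^ 2 = 2 * (1 / c ^ 2) := by ring
  have hR0 : 0 < 1 / R := by positivity
  have gle : ∀ ζ, c ≤ ‖ζ - 1‖ → ‖g ζ‖ ≤ 1 / c := fun ζ h => by
    rw [hg, norm_inv, one_div]; exact inv_anti₀ hc h
  have gle' : ∀ ζ, c ≤ ‖ζ - 1‖ → ‖g ζ‖ ≤ 2 / c ^ 2 := fun ζ h => by
    have := gle ζ h
    linarith
  -- outside the disk `(ζ - 1)⁻¹ = O(1/R)`; for `R < 2` this is the bound by `1 / c`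
  have gout : ∀ ζ, c ≤ ‖ζ - 1‖ → ¬ ‖ζ‖ < R → ‖g ζ‖ ≤ 2 / c ^ 2 * (ε + 1 / R) := by
    intro ζ h h2
    have h5 : ‖g ζ‖ ≤ 2 * (1 / c ^ 2) * (1 / R) := by
      rcases lt_or_ge R 2 with h3 | h3
      · have h4 : 1 / 2 ≤ 1 / R := one_div_le_one_div_of_le (by linarith) h3.le
        have := gle ζ h
        have := mul_le_mul_of_nonneg_left h4 (by positivity : 0 ≤ 2 * (1 / c ^ 2))
        linarith
      · have h4 : R / 2 ≤ ‖ζ - 1‖ := by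
          have := norm_sub_norm_le ζ 1
          rw [norm_one] at this
          linarith
        have h6 : ‖g ζ‖ ≤ 2 * (1 / R) := by
          rw [hg, norm_inv]
          refine (inv_anti₀ (by linarith) h4).trans (le_of_eq ?_)
          field_simp
        refine h6.trans (mul_le_mul_of_nonneg_right ?_ hR0.le)
        linarith
    rw [e2]
    refine h5.trans (mul_le_mul_of_nonneg_left ?_ (by positivity))
    linarith
  refine ⟨v, ?_, ?_, fun i => ?_⟩
  · have := congrArg (fun M => (M.map fun p : ℂ × ℂ => linFactor p.1).prod) hv
    simp only [Multiset.map_map, Function.comp_def] at this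
    change ∏ i, linFactor (v i).1 = _ at this
    rw [this, ← hAA, hM]
    simp [normProd, Multiset.map_map, Function.comp_def, lin0, hg]
  · have := congrArg (fun M => (M.map fun p : ℂ × ℂ => linFactor p.2).prod) hv
    simp only [Multiset.map_map, Function.comp_def] at this
    change ∏ i, linFactor (v i).2 = _ at this
    rw [this, ← hBB, hM]
    simp [normProd, Multiset.map_map, Function.comp_def, lin0, hg]
  · have hi : v i ∈ M + Multiset.replicate (2 * d - M.card) (0, 0) := by
      rw [← hv]
      exact Multiset.mem_map_of_mem _ (Finset.mem_univ i)
    have hpos : 0 ≤ 2 / c ^ 2 * (ε + 1 / R) := by positivity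
    have hpos' : 0 ≤ 2 / c ^ 2 := by positivity
    simp only [hM, Multiset.mem_add, Multiset.mem_map] at hi
    rcases hi with ((⟨j, -, hj⟩ | ⟨ζ, hζ, hj⟩) | ⟨ζ, hζ, hj⟩) | hi
    · have zA : z j ∈ A := by
        rw [← hAA]
        exact Multiset.mem_add.2 (Or.inl (Multiset.mem_map_of_mem _ (Finset.mem_univ j)))
      have wB : w j ∈ B := by
        rw [← hBB]
        exact Multiset.mem_add.2 (Or.inl (Multiset.mem_map_of_mem _ (Finset.mem_univ j)))
      have z1 := hAc _ zA
      have w1 := hBc _ wB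
      rw [← hj]
      refine ⟨gle' _ z1, gle' _ w1, ?_⟩
      have zn : z j - 1 ≠ 0 := norm_pos_iff.1 (hc.trans_le z1)
      have wn : w j - 1 ≠ 0 := norm_pos_iff.1 (hc.trans_le w1)
      have e : g (z j) - g (w j) = -(g (z j) * g (w j) * (z j - w j)) := by
        simp only [hg]; field_simp; ring
      change ‖g (z j) - g (w j)‖ ≤ _
      rw [e, norm_neg, norm_mul, norm_mul]
      calc _ ≤ 1 / c * (1 / c) * ε := by
            have := gle _ z1
            have := gle _ w1
            have := hzw j
            gcongr
        _ = 1 / c ^ 2 * ε := by rw [sq]; field_simp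
        _ ≤ _ := by
            rw [e2]
            refine mul_le_mul ?_ ?_ hε.le (by positivity) <;> linarith
    · obtain ⟨h1, h2⟩ := Multiset.mem_filter.1 hζ
      rw [← hj]
      simpa using ⟨gle' _ (hAc _ h1), hpos', by simpa using gout _ (hAc _ h1) h2⟩
    · obtain ⟨h1, h2⟩ := Multiset.mem_filter.1 hζ
      rw [← hj]
      simpa using ⟨hpos', gle' _ (hBc _ h1), by simpa using gout _ (hBc _ h1) h2⟩
    · rw [(Multiset.eq_of_mem_replicate hi)]
      simpa using ⟨hpos', by simpa using hpos⟩

/-- At every point the order of a quotient of polynomials is the difference of the multiplicities. -/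
theorem meromorphicOrderAt_eval_div_eval {f g : ℂ[X]} (hf : f ≠ 0) (hg : g ≠ 0) (ζ : ℂ) :
    meromorphicOrderAt (fun z => f.eval z / g.eval z) ζ
      = ((f.roots.count ζ - g.roots.count ζ : ℤ) : WithTop ℤ) := by
  have poly : ∀ p : ℂ[X], AnalyticAt ℂ (fun z => p.eval z) ζ := fun p => by
    simpa using AnalyticAt.aeval_polynomial (analyticAt_id (𝕜 := ℂ) (z := ζ)) p
  rw [meromorphicOrderAt_eq_int_iff ((poly f).meromorphicAt.fun_div (poly g).meromorphicAt)]
  obtain ⟨p, hp, hp0⟩ := Polynomial.exists_eq_pow_rootMultiplicity_mul_and_not_dvd f hf ζ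
  obtain ⟨q, hq, hq0⟩ := Polynomial.exists_eq_pow_rootMultiplicity_mul_and_not_dvd g hg ζ
  rw [Polynomial.dvd_iff_isRoot, Polynomial.IsRoot] at hp0 hq0
  refine ⟨fun z => p.eval z / q.eval z, (poly p).div (poly q) hq0, div_ne_zero hp0 hq0, ?_⟩
  filter_upwards [self_mem_nhdsWithin] with z hz
  have hz' : z - ζ ≠ 0 := sub_ne_zero.2 hz
  rw [Polynomial.count_roots, Polynomial.count_roots, zpow_sub₀ hz', zpow_natCast, zpow_natCast,
    smul_eq_mul, div_mul_div_comm]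
  conv_lhs => rw [hp, hq]
  simp

/-- A finite list with the multiplicities of `A` in the disk enumerates that part of `A`. -/
theorem map_eq_filter_of_card {A : Multiset ℂ} {R : ℝ} {m : ℕ} {z : Fin m → ℂ}
    (h1 : ∀ j, ‖z j‖ < R) (h2 : ∀ ζ : ℂ, ‖ζ‖ < R → Nat.card {j // z j = ζ} = A.count ζ) :
    Finset.univ.val.map z = A.filter fun ζ => ‖ζ‖ < R := by
  ext ζ
  rw [Multiset.count_filter]
  split_ifs with hζ
  · rw [← h2 ζ hζ, Multiset.count_map, Nat.card_eq_fintype_card, Fintype.card_subtype]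
    simp only [eq_comm (a := ζ)]
    rfl
  · refine Multiset.count_eq_zero.2 fun h => ?_
    obtain ⟨j, -, rfl⟩ := Multiset.mem_map.1 h
    exact hζ (h1 j)

/-! ### Zeros and poles of the reflection coefficient -/

namespace JacobiDE

theorem natDegree_jostPoly_le (τ : JacobiDE) (N : ℕ) {n : ℤ} (hn : -1 ≤ n) :
    (τ.jostPoly N n).natDegree ≤ 2 * (N + 2) := by
  have h1 := natDegree_jostPolyAux τ N (N + 1 - n).toNat
  have h2 : (N + 1 - n).toNat ≤ N + 2 := by omega
  rw [jostPoly]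
  omega

theorem norm_coeff_jostPoly_le {τ : JacobiDE} {N : ℕ} {Q : ℝ} (hQ : 1 ≤ Q) (h : τ.MemB0 N Q)
    {n : ℤ} (hn : -1 ≤ n) (j : ℕ) : ‖(τ.jostPoly N n).coeff j‖ ≤ (4 * Q ^ 2) ^ (N + 2) :=
  (norm_coeff_jostPolyAux_le hQ h _ j).trans
    (pow_le_pow_right₀ (by nlinarith) (by omega))

theorem natDegree_numPoly_le (τ : JacobiDE) (N : ℕ) : (τ.numPoly N).natDegree ≤ 2 * (N + 2) :=
  (Polynomial.natDegree_sub_le _ _).trans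
    (max_le (natDegree_jostPoly_le τ N (by norm_num)) (natDegree_jostPoly_le τ N le_rfl))

theorem natDegree_denPoly_le (τ : JacobiDE) (N : ℕ) : (τ.denPoly N).natDegree ≤ 2 * (N + 2) := by
  refine (Polynomial.natDegree_sub_le _ _).trans
    (max_le (natDegree_jostPoly_le τ N le_rfl) (Polynomial.natDegree_mul_le.trans ?_))
  have h1 := natDegree_jostPolyAux τ N (N + 1)
  rw [Polynomial.natDegree_X_pow, jostPoly, show ((N : ℤ) + 1 - 0).toNat = N + 1 by omega]
  omega

theorem norm_coeff_numPoly_le {τ : JacobiDE} {N : ℕ} {Q : ℝ} (hQ : 1 ≤ Q) (h : τ.MemB0 N Q)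
    (j : ℕ) : ‖(τ.numPoly N).coeff j‖ ≤ 2 * (4 * Q ^ 2) ^ (N + 2) := by
  rw [numPoly, Polynomial.coeff_sub, two_mul]
  exact (norm_sub_le _ _).trans (add_le_add (norm_coeff_jostPoly_le hQ h (by norm_num) j)
    (norm_coeff_jostPoly_le hQ h le_rfl j))

theorem norm_coeff_denPoly_le {τ : JacobiDE} {N : ℕ} {Q : ℝ} (hQ : 1 ≤ Q) (h : τ.MemB0 N Q)
    (j : ℕ) : ‖(τ.denPoly N).coeff j‖ ≤ 2 * (4 * Q ^ 2) ^ (N + 2) := by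
  rw [denPoly, Polynomial.coeff_sub, two_mul, Polynomial.coeff_X_pow_mul']
  refine (norm_sub_le _ _).trans (add_le_add (norm_coeff_jostPoly_le hQ h le_rfl j) ?_)
  split_ifs
  · exact norm_coeff_jostPoly_le hQ h (by norm_num) _
  · rw [norm_zero]; positivity

theorem jostPoly_coeff_zero_ne_zero {τ : JacobiDE} {N : ℕ} {Q : ℝ} (hQ : 1 ≤ Q)
    (h : τ.MemB0 N Q) (n : ℤ) : (τ.jostPoly N n).coeff 0 ≠ 0 :=
  norm_pos_iff.1 ((by positivity : 0 < Q⁻¹ ^ (N + 1 - n).toNat).trans_le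
    (le_norm_coeff_zero_jostPolyAux hQ h _))

theorem le_norm_coeff_zero_denPoly {τ : JacobiDE} {N : ℕ} {Q : ℝ} (hQ : 1 ≤ Q)
    (h : τ.MemB0 N Q) : Q⁻¹ ^ (N + 2) ≤ ‖(τ.denPoly N).coeff 0‖ := by
  have h1 := le_norm_coeff_zero_jostPolyAux hQ h (N + 2)
  have e : (τ.denPoly N).coeff 0 = (τ.jostPolyAux N (N + 2)).coeff 0 := by
    rw [denPoly, Polynomial.coeff_sub, Polynomial.coeff_X_pow_mul']
    simp [jostPoly, show ((N : ℤ) + 1 + 1).toNat = N + 2 by omega]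
  rwa [e]

theorem MemB.le_norm_eval_one {τ : JacobiDE} {δ : ℝ} {N : ℕ} {Q : ℝ} (h : τ.MemB δ N Q) :
    δ ≤ ‖(τ.numPoly N).eval 1‖ := by
  rw [← sMinus_eq h.supp one_ne_zero]
  exact h.s_one

/-- The zeros of `R⁻` in the plane, with multiplicity. -/
noncomputable def zerosR (τ : JacobiDE) (N : ℕ) : Multiset ℂ :=
  (τ.numPoly N).roots - (τ.denPoly N).roots

/-- The poles of `R⁻` in the plane, with multiplicity. -/
noncomputable def polesR (τ : JacobiDE) (N : ℕ) : Multiset ℂ :=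
  (τ.denPoly N).roots - (τ.numPoly N).roots

theorem numPoly_ne_zero_and_denPoly_ne_zero {τ : JacobiDE} {N : ℕ}
    (h1 : (τ.numPoly N).eval 1 ≠ 0) : τ.numPoly N ≠ 0 ∧ τ.denPoly N ≠ 0 := by
  refine ⟨fun h0 => h1 (by simp [h0]), fun h0 => h1 ?_⟩
  have := eval_one_denPoly τ N
  rw [h0, Polynomial.eval_zero] at this
  exact neg_eq_zero.1 this.symm

section Order

variable {τ : JacobiDE} {N : ℕ} (h : τ.FinitelySupported 0 N) (h1 : (τ.numPoly N).eval 1 ≠ 0)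
include h h1

theorem meromorphicOrderAt_leftReflection (ζ : ℂ) :
    meromorphicOrderAt (τ.leftReflection 0 N) ζ
      = (((τ.numPoly N).roots.count ζ - (τ.denPoly N).roots.count ζ : ℤ) : WithTop ℤ) := by
  obtain ⟨hn, hd⟩ := numPoly_ne_zero_and_denPoly_ne_zero h1
  rw [← meromorphicOrderAt_eval_div_eval hn hd]
  refine meromorphicOrderAt_congr ?_
  have hfin : ({0, 1, -1} : Set ℂ)ᶜ ∈ nhdsWithin ζ {ζ}ᶜ :=
    nhdsNE_le_cofinite ζ (Set.toFinite _).compl_mem_cofinite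
  filter_upwards [hfin] with z hz
  simp only [Set.mem_compl_iff, Set.mem_insert_iff, Set.mem_singleton_iff, not_or] at hz
  exact leftReflection_eq h hz.1 fun h2 => by
    rcases sq_eq_one_iff.1 h2 with h2 | h2
    exacts [hz.2.1 h2, hz.2.2 h2]

theorem map_eq_filter_zerosR {R : ℝ} {m : ℕ} {z : Fin m → ℂ}
    (hz : ListsZeros (τ.leftReflection 0 N) R z) :
    Finset.univ.val.map z = (τ.zerosR N).filter fun ζ => ‖ζ‖ < R := by
  refine map_eq_filter_of_card hz.1 fun ζ hζ => ?_
  rw [hz.2 ζ hζ, meromorphicOrderAt_leftReflection h h1, WithTop.untop₀_coe, zerosR,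
    Multiset.count_sub]
  omega

theorem map_eq_filter_polesR {R : ℝ} {m : ℕ} {z : Fin m → ℂ}
    (hz : ListsPoles (τ.leftReflection 0 N) R z) :
    Finset.univ.val.map z = (τ.polesR N).filter fun ζ => ‖ζ‖ < R := by
  refine map_eq_filter_of_card hz.1 fun ζ hζ => ?_
  rw [hz.2 ζ hζ, meromorphicOrderAt_leftReflection h h1, WithTop.untop₀_coe, polesR,
    Multiset.count_sub]
  omega

end Order

theorem numPoly_mul_normProd {τ : JacobiDE} {N : ℕ} (h1 : (τ.numPoly N).eval 1 ≠ 0) :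
    τ.numPoly N * normProd (τ.polesR N) = -normProd (τ.zerosR N) * τ.denPoly N := by
  have h2 : (τ.denPoly N).eval 1 ≠ 0 := by rwa [eval_one_denPoly, neg_ne_zero]
  have e1 := eq_C_mul_normProd_roots h1
  have e2 := eq_C_mul_normProd_roots h2
  rw [← Multiset.sub_add_inter (τ.numPoly N).roots (τ.denPoly N).roots, normProd_add] at e1
  rw [← Multiset.sub_add_inter (τ.denPoly N).roots (τ.numPoly N).roots, normProd_add,
    Multiset.inter_comm, eval_one_denPoly] at e2
  rw [zerosR, polesR]
  rw [map_neg] at e2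
  linear_combination normProd ((τ.denPoly N).roots - (τ.numPoly N).roots) * e1
    + normProd ((τ.numPoly N).roots - (τ.denPoly N).roots) * e2

/-- Everything that is needed about the zeros and poles of `R⁻`, uniformly over `B_δ(N, Q)`:
they keep a distance from `1`, and the normalized denominator of `R⁻` is bounded below at `0`. -/
theorem exists_uniform_bounds (N : ℕ) {Q : ℝ} (hQ : 1 ≤ Q) {δ : ℝ} (hδ : 0 < δ) :
    ∃ c c₀ : ℝ, 0 < c ∧ c ≤ 1 ∧ 0 < c₀ ∧ ∀ τ : JacobiDE, τ.MemB δ N Q →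
      (τ.zerosR N).card ≤ 2 * (N + 2) ∧ (τ.polesR N).card ≤ 2 * (N + 2) ∧
      (∀ ζ ∈ τ.zerosR N, c ≤ ‖ζ - 1‖) ∧ (∀ ζ ∈ τ.polesR N, c ≤ ‖ζ - 1‖) ∧
      c₀ ≤ ‖(normProd (τ.polesR N)).eval 0‖ := by
  set K : ℝ := 2 * (4 * Q ^ 2) ^ (N + 2) with hK
  have hK0 : 0 < K := by positivity
  obtain ⟨c, hc, hc1, hroot⟩ := exists_le_norm_root_sub_one (2 * (N + 2)) hK0 hδ
  set d := 2 * (N + 2) with hd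
  have hL : 0 < (d + 1) * K * (1 + c⁻¹) ^ d := by positivity
  refine ⟨c, Q⁻¹ ^ (N + 2) / ((d + 1) * K * (1 + c⁻¹) ^ d), hc, hc1, by positivity,
    fun τ h => ?_⟩
  have h1 := h.le_norm_eval_one
  have h2 : δ ≤ ‖(τ.denPoly N).eval 1‖ := by rwa [eval_one_denPoly, norm_neg]
  have hnum := hroot _ (natDegree_numPoly_le τ N) (norm_coeff_numPoly_le hQ h.toMemB0) h1
  have hden := hroot _ (natDegree_denPoly_le τ N) (norm_coeff_denPoly_le hQ h.toMemB0) h2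
  refine ⟨?_, ?_, fun ζ hζ => hnum ζ (Multiset.mem_of_le (Multiset.sub_le_self _ _) hζ),
    fun ζ hζ => hden ζ (Multiset.mem_of_le (Multiset.sub_le_self _ _) hζ), ?_⟩
  · exact (Multiset.card_le_card (Multiset.sub_le_self _ _)).trans
      ((Polynomial.card_roots' _).trans (natDegree_numPoly_le τ N))
  · exact (Multiset.card_le_card (Multiset.sub_le_self _ _)).trans
      ((Polynomial.card_roots' _).trans (natDegree_denPoly_le τ N))
  · -- the common zeros contribute at most `(1 + c⁻¹) ^ d` to the denominator at `0`
    set I := (τ.denPoly N).roots ∩ (τ.numPoly N).roots with hI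
    have hIc : I.card ≤ d := (Multiset.card_le_card Multiset.inter_le_left).trans
      ((Polynomial.card_roots' _).trans (natDegree_denPoly_le τ N))
    have hI0 : ‖(normProd I).eval 0‖ ≤ (1 + c⁻¹) ^ d :=
      (norm_eval_zero_normProd_le hc I fun ζ hζ =>
        hden ζ (Multiset.mem_of_le Multiset.inter_le_left hζ)).trans
        (pow_le_pow_right₀ (by linarith [inv_pos.2 hc]) hIc)
    have h3 : ‖(τ.denPoly N).eval 1‖ ≤ (d + 1) * K := by
      rw [Polynomial.eval_eq_sum_range' (Nat.lt_succ_of_le (natDegree_denPoly_le τ N))]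
      refine (norm_sum_le _ _).trans ((Finset.sum_le_card_nsmul _ _ K fun j _ => ?_).trans ?_)
      · simpa using norm_coeff_denPoly_le hQ h.toMemB0 j
      · simp [hd]
    have e := eq_C_mul_normProd_roots (norm_pos_iff.1 (hδ.trans_le h2))
    rw [← Multiset.sub_add_inter (τ.denPoly N).roots (τ.numPoly N).roots, normProd_add] at e
    have h4 := le_norm_coeff_zero_denPoly hQ h.toMemB0
    have e0 := congrArg (Polynomial.eval 0) e
    rw [Polynomial.eval_mul, Polynomial.eval_mul, Polynomial.eval_C] at e0
    rw [Polynomial.coeff_zero_eq_eval_zero, e0, norm_mul, norm_mul] at h4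
    rw [div_le_iff₀ hL]
    refine h4.trans ?_
    calc _ ≤ (d + 1) * K * (‖(normProd (τ.polesR N)).eval 0‖ * (1 + c⁻¹) ^ d) := by
          rw [polesR]; gcongr
      _ = _ := by ring

/-! ### The continued fraction expansion of the Weyl function -/

/-- The power series of `a_{n-1} P_n / P_{n-1}` at `0`. Up to the factor `z` it is the Weyl
`m`-function `a_{n-1} f⁺(n) / f⁺(n-1)`. -/
noncomputable def weylSeries (τ : JacobiDE) (N : ℕ) (n : ℤ) : ℂ⟦X⟧ :=
  PowerSeries.C (τ.a (n - 1) : ℂ) * (τ.jostPoly N n : ℂ⟦X⟧) * (τ.jostPoly N (n - 1) : ℂ⟦X⟧)⁻¹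

/-- The power series of `R⁻` at `0`. -/
noncomputable def reflectionSeries (τ : JacobiDE) (N : ℕ) : ℂ⟦X⟧ :=
  (τ.numPoly N : ℂ⟦X⟧) * (τ.denPoly N : ℂ⟦X⟧)⁻¹

theorem coe_jostPoly_rec {τ : JacobiDE} {N : ℕ} (h : τ.FinitelySupported 0 N) (n : ℤ) :
    PowerSeries.C (τ.a (n - 1) : ℂ) * (τ.jostPoly N (n - 1) : ℂ⟦X⟧) =
      (1 + PowerSeries.X ^ 2 - PowerSeries.C (τ.b n : ℂ) * PowerSeries.X) * (τ.jostPoly N n : ℂ⟦X⟧)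
        - PowerSeries.C (τ.a n : ℂ) * PowerSeries.X ^ 2 * (τ.jostPoly N (n + 1) : ℂ⟦X⟧) := by
  have := congrArg (fun p : ℂ[X] => (p : ℂ⟦X⟧)) (jostPoly_rec h n)
  simpa using this

section Series

variable {τ : JacobiDE} {N : ℕ} {Q : ℝ} (hQ : 1 ≤ Q) (h : τ.MemB0 N Q)
include hQ h

theorem constantCoeff_jostPoly_ne_zero (n : ℤ) :
    PowerSeries.constantCoeff (τ.jostPoly N n : ℂ⟦X⟧) ≠ 0 := by
  rw [Polynomial.constantCoeff_coe]
  exact jostPoly_coeff_zero_ne_zero hQ h n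

theorem constantCoeff_denPoly_ne_zero :
    PowerSeries.constantCoeff (τ.denPoly N : ℂ⟦X⟧) ≠ 0 := by
  rw [Polynomial.constantCoeff_coe]
  exact norm_pos_iff.1 ((by positivity : 0 < Q⁻¹ ^ (N + 2)).trans_le
    (le_norm_coeff_zero_denPoly hQ h))

theorem constantCoeff_weylSeries (n : ℤ) :
    PowerSeries.constantCoeff (τ.weylSeries N n) = (τ.a (n - 1) : ℂ) ^ 2 := by
  have h1 := constantCoeff_jostPoly_ne_zero hQ h (n - 1)
  have h2 := congrArg PowerSeries.constantCoeff (coe_jostPoly_rec h.supp n)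
  simp only [map_mul, map_sub, map_add, map_one, map_pow, PowerSeries.constantCoeff_C,
    PowerSeries.constantCoeff_X] at h2
  rw [weylSeries, map_mul, map_mul, PowerSeries.constantCoeff_C, PowerSeries.constantCoeff_inv,
    ← div_eq_mul_inv, div_eq_iff h1]
  linear_combination -(τ.a (n - 1) : ℂ) * h2

/-- One step of the continued fraction expansion of the Weyl function. -/
theorem weylSeries_step (n : ℤ) :
    PowerSeries.C ((τ.a (n - 1) : ℂ) ^ 2) * (τ.weylSeries N n)⁻¹ =
      1 - PowerSeries.C (τ.b n : ℂ) * PowerSeries.X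
        + PowerSeries.X ^ 2 * (1 - τ.weylSeries N (n + 1)) := by
  have ha : (τ.a (n - 1) : ℂ) ≠ 0 := by exact_mod_cast τ.a_ne_zero _
  have hw : PowerSeries.constantCoeff (τ.weylSeries N n) ≠ 0 := by
    rw [constantCoeff_weylSeries hQ h]; exact pow_ne_zero 2 ha
  have h1 := PowerSeries.mul_inv_cancel _ (constantCoeff_jostPoly_ne_zero hQ h n)
  have h2 := PowerSeries.mul_inv_cancel _ (constantCoeff_jostPoly_ne_zero hQ h (n - 1))
  have h3 := coe_jostPoly_rec h.supp n
  symm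
  rw [PowerSeries.eq_mul_inv_iff_mul_eq hw, weylSeries, weylSeries, add_sub_cancel_right, map_pow]
  set A := PowerSeries.C (τ.a (n - 1) : ℂ)
  set B := PowerSeries.C (τ.a n : ℂ)
  set p := (τ.jostPoly N (n - 1) : ℂ⟦X⟧)
  set r := (τ.jostPoly N (n + 1) : ℂ⟦X⟧)
  linear_combination -(A * p⁻¹) * h3 - A * p⁻¹ * PowerSeries.X ^ 2 * B * r * h1 + A ^ 2 * h2

/-- The Weyl function at the left end of the support is a Möbius transform of `R⁻`. -/
theorem weylSeries_zero : τ.weylSeries N 0 =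
    (1 + τ.reflectionSeries N) * (1 + PowerSeries.X ^ 2 * τ.reflectionSeries N)⁻¹ := by
  have ha : τ.a (-1) = 1 := by
    by_contra hc
    have := h.supp.a_supp _ hc
    omega
  have h1 := PowerSeries.mul_inv_cancel _ (constantCoeff_jostPoly_ne_zero hQ h (-1))
  have hd := constantCoeff_denPoly_ne_zero hQ h
  have h2 := PowerSeries.mul_inv_cancel _ hd
  have hd0 : (τ.denPoly N : ℂ⟦X⟧) ≠ 0 := fun h0 => hd (by rw [h0, map_zero])
  have e1 : (τ.numPoly N : ℂ⟦X⟧) = (τ.jostPoly N 0 : ℂ⟦X⟧) - (τ.jostPoly N (-1) : ℂ⟦X⟧) := by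
    simp [numPoly]
  have e2 : (τ.denPoly N : ℂ⟦X⟧) =
      (τ.jostPoly N (-1) : ℂ⟦X⟧) - PowerSeries.X ^ 2 * (τ.jostPoly N 0 : ℂ⟦X⟧) := by
    simp [denPoly]
  rw [PowerSeries.eq_mul_inv_iff_mul_eq (by simp), weylSeries, reflectionSeries, zero_sub, ha]
  refine mul_right_cancel₀ hd0 ?_
  simp only [Complex.ofReal_one, map_one, one_mul]
  set p := (τ.jostPoly N (-1) : ℂ⟦X⟧)
  set q := (τ.jostPoly N 0 : ℂ⟦X⟧)
  set s := (τ.numPoly N : ℂ⟦X⟧)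
  set t := (τ.denPoly N : ℂ⟦X⟧)
  have l : (1 + PowerSeries.X ^ 2 * (s * t⁻¹)) * t = (1 - PowerSeries.X ^ 2) * p := by
    linear_combination PowerSeries.X ^ 2 * s * h2 + e2 + PowerSeries.X ^ 2 * e1
  have r : (1 + s * t⁻¹) * t = (1 - PowerSeries.X ^ 2) * q := by
    linear_combination s * h2 + e2 + e1
  rw [mul_assoc, l, r]
  linear_combination q * (1 - PowerSeries.X ^ 2) * h1

end Series

section Families

variable {ι : Type*} {η : ι → NNReal} {T : ι × Bool → JacobiDE} {N : ℕ} {Q : ℝ}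

/-- Inverse scattering: if the power series of the reflection coefficients are `O(η)`-close, so are
all the coefficients, which are read off from the continued fraction expansion. -/
theorem weylSeries_mem_lipSeries (hQ : 1 ≤ Q) (hT : ∀ y, (T y).MemB0 N Q)
    (hρ : (fun y => (T y).reflectionSeries N) ∈ lipSeries η) (n : ℕ) :
    (fun y => (T y).weylSeries N n) ∈ lipSeries η ∧
      (fun y => ((T y).a (n - 1) : ℂ) ^ 2) ∈ lipRing η ∧
      (fun y => ((T y).b n : ℂ)) ∈ lipRing η := by
  have hsq : ∀ n : ℤ, (fun y => (T y).weylSeries N n) ∈ lipSeries η →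
      (fun y => ((T y).a (n - 1) : ℂ) ^ 2) ∈ lipRing η := fun n hn => by
    have := hn 0
    simpa only [PowerSeries.coeff_zero_eq_constantCoeff, constantCoeff_weylSeries hQ (hT _)]
      using this
  -- `a_{n-1}² / m_n` again has coefficients in the ring, because `|a_{n-1}| ≥ 1 / Q`
  have hstep : ∀ n : ℤ, (fun y => (T y).weylSeries N n) ∈ lipSeries η →
      (fun y => 1 - PowerSeries.C ((T y).b n : ℂ) * PowerSeries.X
        + PowerSeries.X ^ 2 * (1 - (T y).weylSeries N (n + 1))) ∈ lipSeries η := fun n hn => by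
    have hQ0 : 0 < (Q⁻¹) ^ 2 := by positivity
    have h1 := inv_mem_lipSeries hn hQ0 fun y => by
      have ha := (hT y).inv_a_le (n - 1)
      have ha0 : 0 < |(T y).a (n - 1)| := abs_pos.2 ((T y).a_ne_zero _)
      rw [constantCoeff_weylSeries hQ (hT y), norm_pow, Complex.norm_real]
      refine pow_le_pow_left₀ (by positivity) ?_ 2
      rw [one_div, abs_inv] at ha
      exact inv_le_of_inv_le₀ ha0 ha
    have h2 := mul_mem (C_mem_lipSeries (hsq n hn)) h1
    have e : (fun y => PowerSeries.C (((T y).a (n - 1) : ℂ) ^ 2)) *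
        (fun y => ((T y).weylSeries N n)⁻¹) = _ :=
      funext fun y => weylSeries_step hQ (hT y) n
    rwa [e] at h2
  have hmem : (fun y => (T y).weylSeries N n) ∈ lipSeries η := by
    induction n with
    | zero =>
      have e : (fun y => (T y).weylSeries N ((0 : ℕ) : ℤ)) =
          (1 + fun y => (T y).reflectionSeries N) *
            fun y => (1 + PowerSeries.X ^ 2 * (T y).reflectionSeries N)⁻¹ :=
        funext fun y => by
          rw [Nat.cast_zero, weylSeries_zero hQ (hT y)]
          rfl
      rw [e]
      refine mul_mem (add_mem (one_mem _) hρ) (inv_mem_lipSeries ?_ one_pos fun y => by simp)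
      exact add_mem (one_mem _) (mul_mem (pow_mem X_mem_lipSeries 2) hρ)
    | succ n ih =>
      intro k
      have h1 := hstep n ih (k + 2)
      have h2 := (lipSeries η).one_mem k
      have e : (fun y => PowerSeries.coeff k ((T y).weylSeries N ((n + 1 : ℕ) : ℤ))) =
          (fun y => PowerSeries.coeff k ((1 : ι × Bool → ℂ⟦X⟧) y)) -
          fun y => PowerSeries.coeff (k + 2) (1 - PowerSeries.C ((T y).b n : ℂ) * PowerSeries.X
            + PowerSeries.X ^ 2 * (1 - (T y).weylSeries N (n + 1))) := by
        funext y
        simp only [Pi.sub_apply, map_add, map_sub, PowerSeries.coeff_X_pow_mul,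
          PowerSeries.coeff_succ_mul_X, Pi.one_apply, PowerSeries.coeff_one, PowerSeries.coeff_C,
          Nat.cast_add, Nat.cast_one]
        simp
      rw [e]
      exact sub_mem h2 h1
  refine ⟨hmem, hsq n hmem, ?_⟩
  have h1 := neg_mem (hstep n hmem 1)
  have e : -(fun y => PowerSeries.coeff 1 (1 - PowerSeries.C ((T y).b n : ℂ) * PowerSeries.X
      + PowerSeries.X ^ 2 * (1 - (T y).weylSeries N (n + 1)))) = fun y => ((T y).b n : ℂ) := by
    funext y
    simp [PowerSeries.coeff_X_pow_mul', PowerSeries.coeff_one]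
  rwa [e] at h1

end Families

end JacobiDE

/-! ### Stability of the reflection coefficient and of the coefficients -/

theorem prod_linFactor_mem_lipSeries {ι : Type*} {η : ι → NNReal} {d : ℕ}
    {u : Fin d → ι × Bool → ℂ} (hu : ∀ i, u i ∈ lipRing η) :
    (fun y => ((∏ i, linFactor (u i y) : ℂ[X]) : ℂ⟦X⟧)) ∈ lipSeries η := by
  have e : (fun y => ((∏ i, linFactor (u i y) : ℂ[X]) : ℂ⟦X⟧)) =
      ∏ i, (1 + (1 - fun _ => PowerSeries.X) * fun y => PowerSeries.C (u i y)) := by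
    funext y
    rw [← Polynomial.coeToPowerSeries.ringHom_apply, map_prod, Finset.prod_apply]
    simp [linFactor]
  rw [e]
  exact prod_mem fun i _ => add_mem (one_mem _)
    (mul_mem (sub_mem (one_mem _) X_mem_lipSeries) (C_mem_lipSeries (hu i)))

/-- A uniformly bounded family of pairs of numbers whose components differ by `O(η)`, viewed as an
element of `lipRing η`. -/
theorem select_mem_lipRing {ι : Type*} {η : ι → NNReal} {K : ℝ} {v : ι → ℂ × ℂ}
    (h : ∀ x, ‖(v x).1‖ ≤ K ∧ ‖(v x).2‖ ≤ K ∧ ‖(v x).1 - (v x).2‖ ≤ K * η x) :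
    (fun y : ι × Bool => if y.2 then (v y.1).1 else (v y.1).2) ∈ lipRing η := by
  refine ⟨K, fun y => ?_, fun x => by simpa using (h x).2.2⟩
  dsimp only
  split_ifs
  exacts [(h y.1).1, (h y.1).2.1]

namespace JacobiDE

theorem reflectionSeries_mem_lipSeries {N : ℕ} {Q : ℝ} (hQ : 1 ≤ Q) {δ : ℝ} (hδ : 0 < δ)
    {ι : Type*} {η : ι → NNReal} {T : ι × Bool → JacobiDE} (hT : ∀ y, (T y).MemB δ N Q)
    (hclose : ∀ x, ∃ R ε : ℝ, 1 ≤ R ∧ 0 < ε ∧ (η x : ℝ) = ε + 1 / R ∧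
      ZerosClose ((T (x, true)).leftReflection 0 N) ((T (x, false)).leftReflection 0 N) R ε ∧
      PolesClose ((T (x, true)).leftReflection 0 N) ((T (x, false)).leftReflection 0 N) R ε) :
    (fun y => (T y).reflectionSeries N) ∈ lipSeries η := by
  obtain ⟨c, c₀, hc, hc1, hc₀, hb⟩ := exists_uniform_bounds N hQ hδ
  have h1 : ∀ y, ((T y).numPoly N).eval 1 ≠ 0 := fun y =>
    norm_pos_iff.1 (hδ.trans_le (hT y).le_norm_eval_one)
  have key : ∀ x, ∃ v w : Fin (2 * (2 * (N + 2))) → ℂ × ℂ,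
      normProd ((T (x, true)).zerosR N) = ∏ i, linFactor (v i).1 ∧
      normProd ((T (x, false)).zerosR N) = ∏ i, linFactor (v i).2 ∧
      normProd ((T (x, true)).polesR N) = ∏ i, linFactor (w i).1 ∧
      normProd ((T (x, false)).polesR N) = ∏ i, linFactor (w i).2 ∧
      (∀ i, ‖(v i).1‖ ≤ 2 / c ^ 2 ∧ ‖(v i).2‖ ≤ 2 / c ^ 2 ∧
        ‖(v i).1 - (v i).2‖ ≤ 2 / c ^ 2 * η x) ∧
      ∀ i, ‖(w i).1‖ ≤ 2 / c ^ 2 ∧ ‖(w i).2‖ ≤ 2 / c ^ 2 ∧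
        ‖(w i).1 - (w i).2‖ ≤ 2 / c ^ 2 * η x := by
    intro x
    obtain ⟨R, ε, hR, hε, hη, ⟨m, z, z', hz, hz', hzz⟩, m', p, p', hp, hp', hpp⟩ := hclose x
    obtain ⟨a1, a2, a3, a4, -⟩ := hb _ (hT (x, true))
    obtain ⟨b1, b2, b3, b4, -⟩ := hb _ (hT (x, false))
    have st := (hT (x, true)).supp
    have sf := (hT (x, false)).supp
    obtain ⟨v, v1, v2, v3⟩ := exists_matched_factors hc hc1 hR hε a1 b1 a3 b3
      (map_eq_filter_zerosR st (h1 _) hz) (map_eq_filter_zerosR sf (h1 _) hz') hzz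
    obtain ⟨w, w1, w2, w3⟩ := exists_matched_factors hc hc1 hR hε a2 b2 a4 b4
      (map_eq_filter_polesR st (h1 _) hp) (map_eq_filter_polesR sf (h1 _) hp') hpp
    rw [hη]
    exact ⟨v, w, v1, v2, w1, w2, v3, w3⟩
  choose v w hv1 hv2 hw1 hw2 hv hw using key
  have hS : (fun y => (normProd ((T y).zerosR N) : ℂ⟦X⟧)) ∈ lipSeries η := by
    have := prod_linFactor_mem_lipSeries fun i => select_mem_lipRing fun x => hv x i
    convert this using 3 with y
    obtain ⟨x, _ | _⟩ := y
    · simpa using hv2 x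
    · simpa using hv1 x
  have hP : (fun y => (normProd ((T y).polesR N) : ℂ⟦X⟧)) ∈ lipSeries η := by
    have := prod_linFactor_mem_lipSeries fun i => select_mem_lipRing fun x => hw x i
    convert this using 3 with y
    obtain ⟨x, _ | _⟩ := y
    · simpa using hw2 x
    · simpa using hw1 x
  have hP0 : ∀ y, c₀ ≤ ‖PowerSeries.constantCoeff (normProd ((T y).polesR N) : ℂ⟦X⟧)‖ := by
    intro y
    rw [Polynomial.constantCoeff_coe, Polynomial.coeff_zero_eq_eval_zero]
    exact (hb _ (hT y)).2.2.2.2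
  have e : (fun y => (T y).reflectionSeries N) =
      -(fun y => (normProd ((T y).zerosR N) : ℂ⟦X⟧)) *
        fun y => (normProd ((T y).polesR N) : ℂ⟦X⟧)⁻¹ := by
    funext y
    have n1 := norm_pos_iff.1 (hc₀.trans_le (hP0 y))
    have n2 := constantCoeff_denPoly_ne_zero hQ (hT y).toMemB0
    have h2 := congrArg (fun q : ℂ[X] => (q : ℂ⟦X⟧)) (numPoly_mul_normProd (h1 y))
    simp only [Polynomial.coe_mul, Polynomial.coe_neg] at h2
    rw [Pi.mul_apply, Pi.neg_apply, PowerSeries.eq_mul_inv_iff_mul_eq n1, reflectionSeries,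
      mul_right_comm, h2, mul_assoc, PowerSeries.mul_inv_cancel _ n2, mul_one]
  rw [e]
  exact mul_mem (neg_mem hS) (inv_mem_lipSeries hP hc₀ hP0)

end JacobiDE

theorem mainTheorem1 (N : ℕ) (Q : ℝ) (hQ : 1 ≤ Q) (δ : ℝ) (hδ0 : 0 < δ) (hδ1 : δ < 1) :
    ∃ C : ℝ, 0 < C ∧ ∀ (R ε : ℝ), 1 ≤ R → 0 < ε →
      ∀ τ τ' : JacobiDE, τ.MemB δ N Q → τ'.MemB δ N Q →
        ZerosClose (τ.leftReflection 0 N) (τ'.leftReflection 0 N) R ε →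
        PolesClose (τ.leftReflection 0 N) (τ'.leftReflection 0 N) R ε →
        ∀ n : ℤ, |τ.b n - τ'.b n| ≤ C * (ε + 1 / R) ∧
          |τ.a n ^ 2 - τ'.a n ^ 2| ≤ C * (ε + 1 / R) := by
  -- the set of all admissible data, over which the constants are uniform
  let ι := {x : (ℝ × ℝ) × (JacobiDE × JacobiDE) // 1 ≤ x.1.1 ∧ 0 < x.1.2 ∧
    x.2.1.MemB δ N Q ∧ x.2.2.MemB δ N Q ∧
    ZerosClose (x.2.1.leftReflection 0 N) (x.2.2.leftReflection 0 N) x.1.1 x.1.2 ∧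
    PolesClose (x.2.1.leftReflection 0 N) (x.2.2.leftReflection 0 N) x.1.1 x.1.2}
  let η : ι → NNReal := fun x => ⟨x.1.1.2 + 1 / x.1.1.1, by
    have h1 := x.2.1
    have h2 := x.2.2.1
    positivity⟩
  let T : ι × Bool → JacobiDE := fun y => if y.2 then y.1.1.2.1 else y.1.1.2.2
  have hT : ∀ y, (T y).MemB δ N Q := by
    rintro ⟨x, _ | _⟩
    exacts [x.2.2.2.2.1, x.2.2.2.1]
  have hρ := JacobiDE.reflectionSeries_mem_lipSeries hQ hδ0 (η := η) hT fun x =>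
    ⟨x.1.1.1, x.1.1.2, x.2.1, x.2.2.1, rfl, x.2.2.2.2.2.1, x.2.2.2.2.2.2⟩
  have hrec := JacobiDE.weylSeries_mem_lipSeries hQ (fun y => (hT y).toMemB0) hρ
  choose A _ hA using fun n : ℕ => (hrec (n + 1)).2.1
  choose B _ hB using fun n : ℕ => (hrec n).2.2
  refine ⟨1 + ∑ n ∈ Finset.range (N + 1), (|A n| + |B n|), by positivity,
    fun R ε hR hε τ τ' hτ hτ' hz hp n => ?_⟩
  set C := 1 + ∑ n ∈ Finset.range (N + 1), (|A n| + |B n|) with hC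
  have hη0 : 0 ≤ ε + 1 / R := by positivity
  by_cases hn : 0 ≤ n ∧ n ≤ N
  · obtain ⟨k, rfl⟩ := Int.eq_ofNat_of_zero_le hn.1
    have hk : |A k| + |B k| ≤ C := by
      have := Finset.single_le_sum (f := fun n => |A n| + |B n|) (fun i _ => by positivity)
        (Finset.mem_range.2 (by omega : k < N + 1))
      linarith
    have hAk := hA k ⟨((R, ε), (τ, τ')), hR, hε, hτ, hτ', hz, hp⟩
    have hBk := hB k ⟨((R, ε), (τ, τ')), hR, hε, hτ, hτ', hz, hp⟩
    have hAk' : ‖(τ.a k : ℂ) ^ 2 - (τ'.a k : ℂ) ^ 2‖ ≤ A k * (ε + 1 / R) := by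
      change _ ≤ A k * (ε + 1 / R) at hAk
      simpa [T] using hAk
    have hBk' : ‖(τ.b k : ℂ) - (τ'.b k : ℂ)‖ ≤ B k * (ε + 1 / R) := by
      change _ ≤ B k * (ε + 1 / R) at hBk
      simpa [T] using hBk
    rw [← Complex.ofReal_pow, ← Complex.ofReal_pow, ← Complex.ofReal_sub, Complex.norm_real] at hAk'
    rw [← Complex.ofReal_sub, Complex.norm_real] at hBk'
    exact ⟨hBk'.trans (mul_le_mul_of_nonneg_right
        (by linarith [le_abs_self (B k), abs_nonneg (A k)]) hη0),
      hAk'.trans (mul_le_mul_of_nonneg_right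
        (by linarith [le_abs_self (A k), abs_nonneg (B k)]) hη0)⟩
  · have hfree : ∀ σ : JacobiDE, σ.MemB δ N Q → σ.a n = 1 ∧ σ.b n = 0 := fun σ hσ => by
      constructor
      · by_contra hc
        have := hσ.supp.a_supp n hc
        omega
      · by_contra hc
        exact hn (hσ.supp.b_supp n hc)
    rw [(hfree τ hτ).1, (hfree τ hτ).2, (hfree τ' hτ').1, (hfree τ' hτ').2]
    have : 0 ≤ C * (ε + 1 / R) := by positivity
    simpa using this
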